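/- Theorem. Let $d\ge 2$, let $K=SU(d)$ be the group of $d\times d$ complex unitary matrices of determinant $1$, with its usual topology and with center $Z(K)$, and let $\mathfrak k=\mathfrak{su}(d)$ be its Lie algebra, i.e. the real vector space of traceless skew-Hermitian $d\times d$ complex matrices with the commutator bracket. Let $\mathrm{Ad}_g(X)=gXg^{-1}$ for $g\in K$, $X\in\mathfrak k$, and let $\mathfrak{gl}(\mathfrak k)$ be the algebra of all real-linear maps $\mathfrak k\to\mathfrak k$. For a matrix $A$ let $\|A\|=\sqrt{\mathrm{tr}(A^\dagger A)}$ be its Frobenius norm, and put $$\mathcal B_K=\Big\{g\in K \;:\; \|g-c\|<\tfrac{1}{\sqrt2}\ \text{ for some } c\in Z(K)\Big\}.$$ Let $S\subseteq K$ be any subset, let $\langle S\rangle=\bigcup_{n\ge 0}\{g_1\cdots g_n : g_1,\dots,g_n\in S\}$ be the set of all words in $S$ (including the empty word $\mathbb 1$), and let $H=\overline{\langle S\rangle}$ be its closure in $K$. Then $H=K$ if and only if both of the following conditions hold: 1. $\{A\in\mathfrak{gl}(\mathfrak k) : A\,\mathrm{Ad}_g=\mathrm{Ad}_g\,A \text{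 for all } g\in S\}=\{\lambda\mathbb 1 : \lambda\in\mathbb R\}$; 2. $H\cap\mathcal B_K\not\subseteq Z(K)$. -/

import Mathlib

open scoped Pointwise Matrix

noncomputable section

namespace GateUniversality

-- Matrices and linear endomorphisms carry the commutator bracket `⁅A, B⁆ = A * B - B * A`.
attribute [local instance 100] LieRing.ofAssociativeRing

/-- The special unitary group `SU(d)`, a group with the topology induced from complex matrices. -/
abbrev SU (d : ℕ) : Type := Matrix.specialUnitaryGroup (Fin d) ℂ

/-- The real Lie algebra `𝔰𝔲(d)` of `SU(d)`: traceless skew-Hermitian complex matrices, with the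
commutator bracket. -/
def su (d : ℕ) : LieSubalgebra ℝ (Matrix (Fin d) (Fin d) ℂ) where
  carrier := {X | Xᴴ = -X ∧ X.trace = 0}
  add_mem' := by
    rintro X Y ⟨hX, hX'⟩ ⟨hY, hY'⟩
    refine ⟨?_, ?_⟩
    · rw [Matrix.conjTranspose_add, hX, hY, neg_add]
    · rw [Matrix.trace_add, hX', hY', add_zero]
  zero_mem' := by
    refine ⟨?_, ?_⟩ <;> simp
  smul_mem' := by
    rintro r X ⟨hX, hX'⟩
    refine ⟨?_, ?_⟩
    · rw [Matrix.conjTranspose_smul, hX, star_trivial, smul_neg]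
    · rw [Matrix.trace_smul, hX', smul_zero]
  lie_mem' := by
    rintro X Y ⟨hX, hX'⟩ ⟨hY, hY'⟩
    refine ⟨?_, ?_⟩
    · rw [Ring.lie_def, Matrix.conjTranspose_sub, Matrix.conjTranspose_mul,
        Matrix.conjTranspose_mul, hX, hY, neg_mul_neg, neg_mul_neg, neg_sub]
    · rw [Ring.lie_def, Matrix.trace_sub, Matrix.trace_mul_comm, sub_self]

/-- Conjugation by a special unitary matrix preserves `𝔰𝔲(d)`. -/
theorem conj_mem_su {d : ℕ} (g : SU d) {X : Matrix (Fin d) (Fin d) ℂ} (hX : X ∈ su d) :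
    (g : Matrix (Fin d) (Fin d) ℂ) * X * ((g⁻¹ : SU d) : Matrix (Fin d) (Fin d) ℂ) ∈ su d := by
  obtain ⟨h1, h2⟩ := hX
  have hinv : ((g⁻¹ : SU d) : Matrix (Fin d) (Fin d) ℂ) = (g : Matrix (Fin d) (Fin d) ℂ)ᴴ := rfl
  have hg : (g : Matrix (Fin d) (Fin d) ℂ)ᴴ * (g : Matrix (Fin d) (Fin d) ℂ) = 1 := g.2.1.1
  refine ⟨?_, ?_⟩
  · rw [hinv, Matrix.conjTranspose_mul, Matrix.conjTranspose_mul, Matrix.conjTranspose_conjTranspose,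
      h1, neg_mul, mul_neg, Matrix.mul_assoc]
  · rw [hinv, Matrix.trace_mul_comm, ← Matrix.mul_assoc, hg, Matrix.one_mul, h2]

/-- The adjoint representation `Ad_g X = g X g⁻¹` of `SU(d)` on its Lie algebra. -/
def Ad (d : ℕ) : SU d →* Module.End ℝ (su d) where
  toFun g :=
    { toFun := fun X => ⟨(g : Matrix (Fin d) (Fin d) ℂ) * (X : Matrix (Fin d) (Fin d) ℂ) *
        ((g⁻¹ : SU d) : Matrix (Fin d) (Fin d) ℂ), conj_mem_su g X.2⟩
      map_add' := by
        intro X Y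
        apply Subtype.ext
        simp [Matrix.mul_add, Matrix.add_mul]
      map_smul' := by
        intro r X
        apply Subtype.ext
        simp }
  map_one' := by
    ext1 X
    apply Subtype.ext
    simp
  map_mul' g h := by
    ext1 X
    apply Subtype.ext
    simp [mul_inv_rev, Matrix.mul_assoc]

/-- The set `⟨S⟩` of all words `g₁ ⋯ gₙ`, `n ≥ 0`, with letters in `S` (no inverses taken);
`S ^ n` is the set of products of `n` elements of `S`. -/
def words {K : Type*} [Group K] (S : Set K) : Set K := ⋃ n : ℕ, S ^ n

/-- The Frobenius norm `√(tr (Aᴴ A))` of a complex matrix (the trace is real and nonnegative). -/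
def frobeniusNorm {d : ℕ} (A : Matrix (Fin d) (Fin d) ℂ) : ℝ := Real.sqrt (Aᴴ * A).trace.re

/-- The elements of `SU(d)` at Frobenius distance less than `1/√2` from some central element. -/
def nearCenter (d : ℕ) : Set (SU d) :=
  {g | ∃ c ∈ Subgroup.center (SU d),
    frobeniusNorm ((g : Matrix (Fin d) (Fin d) ℂ) - (c : Matrix (Fin d) (Fin d) ℂ)) <
      1 / Real.sqrt 2}

/-- The centralizer of `Ad_S` in `𝔤𝔩(𝔰𝔲(d))`, the algebra of all real-linear endomorphisms of
`𝔰𝔲(d)`. -/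
def commutantAd {d : ℕ} (S : Set (SU d)) : Set (Module.End ℝ (su d)) :=
  {A | ∀ g ∈ S, ⁅A, Ad d g⁆ = 0}

end GateUniversality

end

/-!
The closure `H` of the words in `S` is a closed subgroup, because in a compact group a closed
submonoid is closed under inverses.

Suppose that the two conditions hold. A subspace of `𝔰𝔲(d)` invariant under `Ad_H` has an invariant
orthogonal complement for the Frobenius inner product, so the orthogonal projection onto it commutes
with `Ad_S` and is a scalar: the only invariant subspaces are `0` and `𝔰𝔲(d)`
(`eq_bot_or_eq_top_of_commutantAd`). This is applied to one of two subspaces.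

* If `H` is infinite, its Lie algebra `tangentSpace H` is invariant, and it is not zero: directions of
  elements of `H` converging to `1` accumulate, and every sequential tangent direction generates a
  one-parameter group in `H` (`mem_oneParam_of_tendsto`). So it is all of `𝔰𝔲(d)`, and `H` is
  everything because the exponential map is onto (`exists_mem_su_exp_eq`).
* If `H` is finite, its elements at distance less than `1/√2` from the center commute with each other
  (`mul_comm_of_mem_nearCenter`). Here the commutator bound `‖gB - Bg‖ ≤ √2 ‖g - 1‖ ‖B‖` makes
  iterated group commutators contract to `1`, and an averaging argument
  (`commutator_eq_one_of_commute`) shows that they were trivial from the start. The set of these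
  elements is stable under conjugation by `H`, so its fixed vectors in `𝔰𝔲(d)` form an invariant
  subspace `fixedNearCenter H`. It contains the traceless skew-Hermitian parts of `h` and `ih` for
  every such `h`. If these all vanish, `h` is scalar; if every vector is fixed, `h` commutes with
  `exp 𝔰𝔲(d) = SU(d)`. In both cases `h` is central, against the second condition.

Conversely, if `H = SU(d)`, an endomorphism commuting with `Ad_S` commutes with `Ad_g` for all `g` by
continuity. Equivariance under reflections and transpositions makes it a scalar on each
`i (E_jj - E_kk)`, the scalars agree, and every element of `𝔰𝔲(d)` is unitarily conjugate to a real
combination of these (`exists_eq_smul_one_of_commute_Ad`). The second condition is witnessed by an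
explicit diagonal matrix.
-/

namespace GateUniversality

open scoped Matrix.Norms.Frobenius
open NormedSpace (exp)
open Filter Topology

attribute [local instance 100] LieRing.ofAssociativeRing

/-! ### Unitary matrices and the Frobenius norm -/

section Matrices

variable {n : Type*} [Fintype n] [DecidableEq n]

theorem norm_sq_eq_sum (A : Matrix n n ℂ) : ‖A‖ ^ 2 = ∑ i, ∑ j, ‖A i j‖ ^ 2 := by
  rw [Matrix.frobenius_norm_def, ← Real.sqrt_eq_rpow, Real.sq_sqrt (by positivity)]
  simp

theorem trace_conjTranspose_mul_self_re (A : Matrix n n ℂ) : (Aᴴ * A).trace.re = ‖A‖ ^ 2 := by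
  rw [norm_sq_eq_sum, Finset.sum_comm, Matrix.trace, Complex.re_sum]
  refine Finset.sum_congr rfl fun j _ => ?_
  rw [Matrix.diag_apply, Matrix.mul_apply, Complex.re_sum]
  refine Finset.sum_congr rfl fun i _ => ?_
  rw [Matrix.conjTranspose_apply, ← Complex.normSq_eq_norm_sq]
  simp [Complex.normSq_apply]

theorem frobeniusNorm_eq_norm {d : ℕ} (A : Matrix (Fin d) (Fin d) ℂ) : frobeniusNorm A = ‖A‖ := by
  rw [frobeniusNorm, trace_conjTranspose_mul_self_re, Real.sqrt_sq (norm_nonneg A)]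

theorem norm_unitary_mul {U : Matrix n n ℂ} (hU : U ∈ Matrix.unitaryGroup n ℂ) (A : Matrix n n ℂ) :
    ‖U * A‖ = ‖A‖ := by
  rw [← sq_eq_sq₀ (norm_nonneg _) (norm_nonneg _), ← trace_conjTranspose_mul_self_re,
    ← trace_conjTranspose_mul_self_re, Matrix.conjTranspose_mul, Matrix.mul_assoc,
    ← Matrix.mul_assoc Uᴴ, ← Matrix.star_eq_conjTranspose U, hU.1, Matrix.one_mul]

theorem norm_mul_unitary {U : Matrix n n ℂ} (hU : U ∈ Matrix.unitaryGroup n ℂ) (A : Matrix n n ℂ) :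
    ‖A * U‖ = ‖A‖ := by
  rw [← Matrix.frobenius_norm_conjTranspose, Matrix.conjTranspose_mul,
    ← Matrix.star_eq_conjTranspose U, norm_unitary_mul (Unitary.star_mem hU),
    Matrix.frobenius_norm_conjTranspose]

theorem exists_unitary_diagonal_of_isHermitian {A : Matrix n n ℂ} (hA : A.IsHermitian) :
    ∃ U ∈ Matrix.unitaryGroup n ℂ, ∃ a : n → ℝ,
      A = U * Matrix.diagonal (fun j => (a j : ℂ)) * Uᴴ :=
  ⟨hA.eigenvectorUnitary, hA.eigenvectorUnitary.2, hA.eigenvalues, hA.spectral_theorem⟩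

theorem infinite_unit_complex : {z : ℂ | ‖z‖ = 1}.Infinite := by
  refine ((Set.Ioo_infinite (zero_lt_one' ℝ)).image
    (f := fun t : ℝ => Complex.exp (t * Complex.I)) ?_).mono ?_
  · intro s hs t ht hst
    have h := congrArg Complex.arg hst
    have hpi := Real.pi_gt_three
    simp only [Complex.arg_exp_mul_I] at h
    rwa [(toIocMod_eq_self _).2, (toIocMod_eq_self _).2] at h
    · exact ⟨by linarith [ht.1], by linarith [ht.2]⟩
    · exact ⟨by linarith [hs.1], by linarith [hs.2]⟩
  · rintro _ ⟨t, -, rfl⟩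
    exact Complex.norm_exp_ofReal_mul_I t

/-- A unitary matrix `g` without eigenvalue `-1` is diagonalizable: its Cayley transform
`A = i (1 - g) (1 + g)⁻¹` is Hermitian, and an eigenbasis of `A` diagonalizes `g`. -/
theorem exists_unitary_diagonal_of_isUnit_one_add {g : Matrix n n ℂ}
    (hg : g ∈ Matrix.unitaryGroup n ℂ) (h1 : IsUnit (1 + g)) :
    ∃ U ∈ Matrix.unitaryGroup n ℂ, ∃ μ : n → ℂ, g = U * Matrix.diagonal μ * Uᴴ := by
  obtain ⟨v, hv⟩ := h1
  set w : Matrix n n ℂ := ((v⁻¹ : (Matrix n n ℂ)ˣ) : Matrix n n ℂ) with hw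
  have hvw : (1 + g) * w = 1 := by rw [← hv]; exact v.mul_inv
  have hwv : w * (1 + g) = 1 := by rw [← hv]; exact v.inv_mul
  have hgg : gᴴ * g = 1 := hg.1
  set A : Matrix n n ℂ := Complex.I • ((1 - g) * w) with hA
  have hAg : A * (1 + g) = Complex.I • (1 - g) := by
    rw [hA, smul_mul_assoc, Matrix.mul_assoc, hwv, Matrix.mul_one]
  have hHerm : A.IsHermitian := by
    have e1 : wᴴ * (1 + gᴴ) = 1 := by
      have := congrArg Matrix.conjTranspose hvw
      simpa using this
    have e3 : (1 - gᴴ) * (1 + g) = -((1 + gᴴ) * (1 - g)) := by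
      simp only [sub_mul, add_mul, mul_sub, mul_add, hgg, Matrix.one_mul, Matrix.mul_one]
      abel
    have e2 : wᴴ * (1 - gᴴ) = -((1 - g) * w) := by
      calc wᴴ * (1 - gᴴ) = wᴴ * ((1 - gᴴ) * (1 + g)) * w := by
            rw [Matrix.mul_assoc, Matrix.mul_assoc, hvw, Matrix.mul_one]
        _ = -(wᴴ * (1 + gᴴ) * ((1 - g) * w)) := by rw [e3]; noncomm_ring
        _ = _ := by rw [e1, Matrix.one_mul]
    rw [Matrix.IsHermitian, hA, Matrix.conjTranspose_smul, Matrix.conjTranspose_mul]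
    simp [e2]
  clear_value A
  obtain ⟨U, hU, a, hUa⟩ := exists_unitary_diagonal_of_isHermitian hHerm
  have hUU : Uᴴ * U = 1 := hU.1
  have hUU' : U * Uᴴ = 1 := hU.2
  have ha : ∀ j, (a j : ℂ) + Complex.I ≠ 0 := fun j h => by
    have := congrArg Complex.im h
    simp at this
  refine ⟨U, hU, fun j => ((a j : ℂ) + Complex.I)⁻¹ * (Complex.I - a j), ?_⟩
  -- `(A + i) g = i - A`, transported to the eigenbasis of `A`
  have key : Matrix.diagonal (fun j => (a j : ℂ) + Complex.I) * (Uᴴ * g * U) =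
      Matrix.diagonal (fun j => Complex.I - (a j : ℂ)) := by
    have e1 : (A + Complex.I • 1) * g = Complex.I • 1 - A := by
      have : A + A * g = Complex.I • 1 - Complex.I • g := by
        rw [← smul_sub, ← hAg, mul_add, mul_one]
      rw [add_mul, smul_mul_assoc, Matrix.one_mul, eq_sub_iff_add_eq, add_right_comm,
        add_comm (A * g), this]
      abel
    have e2 : Matrix.diagonal (fun j => (a j : ℂ)) = Uᴴ * A * U := by
      rw [hUa]
      simp only [Matrix.mul_assoc, hUU, Matrix.mul_one]
      rw [← Matrix.mul_assoc, hUU, Matrix.one_mul]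
    have e3 : Matrix.diagonal (fun j => (a j : ℂ) + Complex.I) =
        Uᴴ * (A + Complex.I • 1) * U := by
      rw [mul_add, add_mul, ← e2, mul_smul_comm, smul_mul_assoc, mul_one, hUU,
        ← Matrix.diagonal_one, ← Matrix.diagonal_smul, Matrix.diagonal_add]
      simp [Pi.smul_apply]
    have e4 : Matrix.diagonal (fun j => Complex.I - (a j : ℂ)) =
        Uᴴ * (Complex.I • 1 - A) * U := by
      rw [mul_sub, sub_mul, ← e2, mul_smul_comm, smul_mul_assoc, mul_one, hUU,
        ← Matrix.diagonal_one, ← Matrix.diagonal_smul, Matrix.diagonal_sub]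
      simp [Pi.smul_apply]
    rw [e3, e4, ← e1]
    calc Uᴴ * (A + Complex.I • 1) * U * (Uᴴ * g * U)
        = Uᴴ * (A + Complex.I • 1) * (U * Uᴴ) * g * U := by simp only [Matrix.mul_assoc]
      _ = _ := by rw [hUU', Matrix.mul_one]; simp only [Matrix.mul_assoc]
  have key2 : Uᴴ * g * U =
      Matrix.diagonal (fun j => ((a j : ℂ) + Complex.I)⁻¹ * (Complex.I - a j)) := by
    rw [← Matrix.diagonal_mul_diagonal, ← key, ← Matrix.mul_assoc, Matrix.diagonal_mul_diagonal]
    simp [ha]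
  rw [← key2]
  calc g = (U * Uᴴ) * g * (U * Uᴴ) := by rw [hUU', Matrix.one_mul, Matrix.mul_one]
    _ = _ := by simp only [Matrix.mul_assoc]

theorem smul_mem_unitaryGroup {c : ℂ} (hc : ‖c‖ = 1) {g : Matrix n n ℂ}
    (hg : g ∈ Matrix.unitaryGroup n ℂ) : c • g ∈ Matrix.unitaryGroup n ℂ := by
  rw [Matrix.mem_unitaryGroup_iff, star_smul, smul_mul_smul_comm,
    Matrix.mem_unitaryGroup_iff.1 hg]
  have : c * star c = 1 := by
    rw [Complex.star_def, Complex.mul_conj, Complex.normSq_eq_norm_sq, hc]; simp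
  rw [this, one_smul]

theorem diagonal_mem_unitaryGroup {μ : n → ℂ} (hμ : ∀ j, ‖μ j‖ = 1) :
    Matrix.diagonal μ ∈ Matrix.unitaryGroup n ℂ := by
  rw [Matrix.mem_unitaryGroup_iff, Matrix.star_eq_conjTranspose, Matrix.diagonal_conjTranspose,
    Matrix.diagonal_mul_diagonal, ← Matrix.diagonal_one]
  congr 1
  funext j
  rw [Pi.star_apply, Complex.star_def, Complex.mul_conj, Complex.normSq_eq_norm_sq, hμ]; simp

/-- Spectral theorem for unitary matrices. -/
theorem exists_unitary_diagonal {g : Matrix n n ℂ} (hg : g ∈ Matrix.unitaryGroup n ℂ) :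
    ∃ U ∈ Matrix.unitaryGroup n ℂ, ∃ μ : n → ℂ, (∀ j, ‖μ j‖ = 1) ∧
      g = U * Matrix.diagonal μ * Uᴴ := by
  -- a phase `c` such that `-1` is not an eigenvalue of `c⁻¹ g`
  obtain ⟨c, hc1, hc2⟩ : ∃ c : ℂ, ‖c‖ = 1 ∧ (-c) ∉ g.charpoly.roots := by
    obtain ⟨c, hc, hc'⟩ := (infinite_unit_complex).exists_notMem_finset g.charpoly.roots.toFinset
    exact ⟨-c, by simpa using hc, by simpa using hc'⟩
  have hc0 : c ≠ 0 := by rintro rfl; simp at hc1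
  have hunit : IsUnit (1 + c⁻¹ • g) := by
    rw [Polynomial.mem_roots (Matrix.charpoly_monic g).ne_zero, Polynomial.IsRoot,
      Matrix.eval_charpoly] at hc2
    rw [Matrix.isUnit_iff_isUnit_det, isUnit_iff_ne_zero]
    intro h0
    apply hc2
    have : Matrix.scalar n (-c) - g = (-c) • (1 + c⁻¹ • g) := by
      rw [smul_add, smul_smul, neg_mul, mul_inv_cancel₀ hc0, neg_one_smul, sub_eq_add_neg,
        Matrix.scalar_apply, Matrix.smul_one_eq_diagonal]
    rw [this, Matrix.det_smul, h0, mul_zero]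
  obtain ⟨U, hU, μ, h⟩ := exists_unitary_diagonal_of_isUnit_one_add
    (smul_mem_unitaryGroup (c := c⁻¹) (by simp [hc1]) hg) hunit
  have hg' : g = U * Matrix.diagonal (c • μ) * Uᴴ := by
    rw [Matrix.diagonal_smul, mul_smul_comm, smul_mul_assoc, ← h, smul_smul, mul_inv_cancel₀ hc0,
      one_smul]
  refine ⟨U, hU, c • μ, ?_, hg'⟩
  have hUU : Uᴴ * U = 1 := hU.1
  have hD : Matrix.diagonal (c • μ) = Uᴴ * g * U := by
    rw [hg']
    simp only [Matrix.mul_assoc, hUU, Matrix.mul_one]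
    rw [← Matrix.mul_assoc, hUU, Matrix.one_mul]
  have hDU : Matrix.diagonal (c • μ) ∈ Matrix.unitaryGroup n ℂ := by
    rw [hD]; exact mul_mem (mul_mem (Unitary.star_mem hU) hg) hU
  intro j
  have := congrFun (congrFun (Matrix.mem_unitaryGroup_iff.1 hDU) j) j
  rw [Matrix.star_eq_conjTranspose, Matrix.diagonal_conjTranspose, Matrix.diagonal_mul_diagonal,
    Matrix.diagonal_apply_eq, Matrix.one_apply_eq, Pi.star_apply, Complex.star_def,
    Complex.mul_conj, Complex.normSq_eq_norm_sq] at this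
  have h2 : ‖(c • μ) j‖ ^ 2 = 1 := by exact_mod_cast this
  exact (pow_eq_one_iff_of_nonneg (norm_nonneg _) two_ne_zero).1 h2

theorem norm_diagonal_commutator_le (μ : n → ℂ) (B : Matrix n n ℂ) :
    ‖Matrix.diagonal μ * B - B * Matrix.diagonal μ‖ ^ 2 ≤
      2 * ‖Matrix.diagonal μ - 1‖ ^ 2 * ‖B‖ ^ 2 := by
  have hD : ‖Matrix.diagonal μ - 1‖ ^ 2 = ∑ i, ‖μ i - 1‖ ^ 2 := by
    rw [← Matrix.diagonal_one, Matrix.diagonal_sub, Matrix.frobenius_norm_diagonal,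
      EuclideanSpace.norm_sq_eq]
  rw [norm_sq_eq_sum, norm_sq_eq_sum B, Finset.mul_sum]
  refine Finset.sum_le_sum fun i _ => ?_
  rw [Finset.mul_sum]
  refine Finset.sum_le_sum fun j _ => ?_
  rw [Matrix.sub_apply, Matrix.diagonal_mul, Matrix.mul_diagonal, mul_comm (B i j), ← sub_mul,
    norm_mul, mul_pow]
  refine mul_le_mul_of_nonneg_right ?_ (by positivity)
  rcases eq_or_ne i j with rfl | hij
  · simp
  have h1 : ‖μ i - μ j‖ ≤ ‖μ i - 1‖ + ‖μ j - 1‖ := by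
    have := norm_sub_le (μ i - 1) (μ j - 1)
    simpa using this
  have h2 : ‖μ i - 1‖ ^ 2 + ‖μ j - 1‖ ^ 2 ≤ ‖Matrix.diagonal μ - 1‖ ^ 2 := by
    rw [hD, ← Finset.sum_pair hij (f := fun i => ‖μ i - 1‖ ^ 2)]
    exact Finset.sum_le_sum_of_subset_of_nonneg (Finset.subset_univ _) (fun _ _ _ => by positivity)
  nlinarith [norm_nonneg (μ i - μ j), norm_nonneg (μ i - 1), norm_nonneg (μ j - 1),
    sq_nonneg (‖μ i - 1‖ - ‖μ j - 1‖), mul_self_le_mul_self (norm_nonneg (μ i - μ j)) h1]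

/-- The Böttcher–Wenzel commutator bound. It is elementary when one of the matrices is unitary:
in an eigenbasis of `g` the entries of the commutator are `(μᵢ - μⱼ) Bᵢⱼ`. -/
theorem norm_commutator_le {g : Matrix n n ℂ} (hg : g ∈ Matrix.unitaryGroup n ℂ)
    (B : Matrix n n ℂ) : ‖g * B - B * g‖ ≤ √2 * ‖g - 1‖ * ‖B‖ := by
  obtain ⟨U, hU, μ, -, rfl⟩ := exists_unitary_diagonal hg
  have hUs : Uᴴ ∈ Matrix.unitaryGroup n ℂ := Unitary.star_mem hU
  have hUU : Uᴴ * U = 1 := hU.1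
  have hUU' : U * Uᴴ = 1 := hU.2
  have e1 : U * Matrix.diagonal μ * Uᴴ * B - B * (U * Matrix.diagonal μ * Uᴴ) =
      U * (Matrix.diagonal μ * (Uᴴ * B * U) - (Uᴴ * B * U) * Matrix.diagonal μ) * Uᴴ := by
    calc _ = U * Matrix.diagonal μ * Uᴴ * B * (U * Uᴴ) -
          (U * Uᴴ) * B * (U * Matrix.diagonal μ * Uᴴ) := by
            rw [hUU', Matrix.mul_one, Matrix.one_mul]
      _ = _ := by noncomm_ring
  have e2 : U * Matrix.diagonal μ * Uᴴ - 1 = U * (Matrix.diagonal μ - 1) * Uᴴ := by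
    rw [mul_sub, sub_mul, mul_one, hUU']
  have e3 : ‖Uᴴ * B * U‖ = ‖B‖ := by rw [norm_mul_unitary hU, norm_unitary_mul hUs]
  rw [e1, e2, norm_mul_unitary hUs, norm_unitary_mul hU, norm_mul_unitary hUs, norm_unitary_mul hU,
    ← e3]
  refine le_of_sq_le_sq ?_ (by positivity)
  rw [mul_pow, mul_pow, Real.sq_sqrt zero_le_two]
  exact norm_diagonal_commutator_le μ _

end Matrices

/-! ### One-parameter subgroups of closed subgroups -/

section Matrices

variable {n : Type*} [Fintype n] [DecidableEq n]

theorem exp_unitary_conj {U : Matrix n n ℂ} (hU : U ∈ Matrix.unitaryGroup n ℂ) (A : Matrix n n ℂ) :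
    exp (U * A * Uᴴ) = U * exp A * Uᴴ := by
  have hinv : U⁻¹ = Uᴴ := Matrix.inv_eq_left_inv hU.1
  rw [← hinv]
  exact Matrix.exp_conj U A ⟨⟨U, Uᴴ, hU.2, hU.1⟩, rfl⟩

theorem exp_diagonal_complex (μ : n → ℂ) :
    exp (Matrix.diagonal μ) = Matrix.diagonal fun j => Complex.exp (μ j) := by
  rw [Matrix.exp_diagonal]
  congr 1
  funext j
  rw [Pi.coe_exp, Complex.exp_eq_exp_ℂ]

theorem det_unitary_conj {U : Matrix n n ℂ} (hU : U ∈ Matrix.unitaryGroup n ℂ) (A : Matrix n n ℂ) :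
    (U * A * Uᴴ).det = A.det := by
  have hUU : Uᴴ * U = 1 := hU.1
  rw [Matrix.det_mul_comm, ← Matrix.mul_assoc, hUU, Matrix.one_mul]

theorem trace_unitary_conj {U : Matrix n n ℂ} (hU : U ∈ Matrix.unitaryGroup n ℂ)
    (A : Matrix n n ℂ) : (U * A * Uᴴ).trace = A.trace := by
  have hUU : Uᴴ * U = 1 := hU.1
  rw [Matrix.trace_mul_comm, ← Matrix.mul_assoc, hUU, Matrix.one_mul]

theorem exists_unitary_diagonal_of_skew {X : Matrix n n ℂ} (hX : Xᴴ = -X) :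
    ∃ U ∈ Matrix.unitaryGroup n ℂ, ∃ a : n → ℝ,
      X = U * Matrix.diagonal (fun j => Complex.I * (a j : ℂ)) * Uᴴ := by
  have hH : (-Complex.I • X).IsHermitian := by
    rw [Matrix.IsHermitian, Matrix.conjTranspose_smul, hX]
    simp
  obtain ⟨U, hU, a, h⟩ := exists_unitary_diagonal_of_isHermitian hH
  refine ⟨U, hU, a, ?_⟩
  have : (fun j => Complex.I * (a j : ℂ)) = Complex.I • fun j => (a j : ℂ) := rfl
  rw [this, Matrix.diagonal_smul, mul_smul_comm, smul_mul_assoc, ← h, smul_smul]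
  simp

theorem exp_mem_unitaryGroup_of_skew {X : Matrix n n ℂ} (hX : Xᴴ = -X) :
    exp X ∈ Matrix.unitaryGroup n ℂ := by
  rw [Matrix.mem_unitaryGroup_iff', Matrix.star_eq_conjTranspose, ← Matrix.exp_conjTranspose, hX,
    ← Matrix.exp_add_of_commute _ _ (Commute.neg_left (Commute.refl X)), neg_add_cancel,
    NormedSpace.exp_zero]

theorem det_exp_of_skew {X : Matrix n n ℂ} (hX : Xᴴ = -X) :
    (exp X).det = Complex.exp X.trace := by
  obtain ⟨U, hU, a, rfl⟩ := exists_unitary_diagonal_of_skew hX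
  rw [exp_unitary_conj hU, det_unitary_conj hU, trace_unitary_conj hU, exp_diagonal_complex,
    Matrix.det_diagonal, Matrix.trace_diagonal, Complex.exp_sum]

theorem norm_pow_sub_pow_le {u v : Matrix n n ℂ} (hu : u ∈ Matrix.unitaryGroup n ℂ)
    (hv : v ∈ Matrix.unitaryGroup n ℂ) (m : ℕ) : ‖u ^ m - v ^ m‖ ≤ m * ‖u - v‖ := by
  induction m with
  | zero => simp
  | succ m ih =>
    have e : u ^ (m + 1) - v ^ (m + 1) = (u ^ m - v ^ m) * u + v ^ m * (u - v) := by
      rw [pow_succ, pow_succ]; noncomm_ring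
    calc ‖u ^ (m + 1) - v ^ (m + 1)‖ ≤ ‖(u ^ m - v ^ m) * u‖ + ‖v ^ m * (u - v)‖ := by
          rw [e]; exact norm_add_le _ _
      _ = ‖u ^ m - v ^ m‖ + ‖u - v‖ := by
          rw [norm_mul_unitary hu, norm_unitary_mul (pow_mem hv m)]
      _ ≤ _ := by push_cast; linarith

end Matrices

variable {d : ℕ}

theorem coe_inv_SU (g : SU d) : ((g⁻¹ : SU d) : Matrix (Fin d) (Fin d) ℂ) = (g : Matrix _ _ ℂ)ᴴ :=
  rfl

theorem SU_mem_unitaryGroup (g : SU d) : (g : Matrix (Fin d) (Fin d) ℂ) ∈ Matrix.unitaryGroup _ ℂ :=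
  g.2.1

theorem diagonal_mem_su {a : Fin d → ℝ} (ha : ∑ j, a j = 0) :
    Matrix.diagonal (fun j => Complex.I * (a j : ℂ)) ∈ su d := by
  constructor
  · rw [Matrix.diagonal_conjTranspose, Matrix.diagonal_neg]
    congr 1
    funext j
    simp
  · rw [Matrix.trace_diagonal, ← Finset.mul_sum, ← Complex.ofReal_sum, ha]
    simp

theorem unitary_conj_mem_su {U : Matrix (Fin d) (Fin d) ℂ} (hU : U ∈ Matrix.unitaryGroup (Fin d) ℂ)
    {X : Matrix (Fin d) (Fin d) ℂ} (hX : X ∈ su d) : U * X * Uᴴ ∈ su d := by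
  obtain ⟨h1, h2⟩ := hX
  refine ⟨?_, by rw [trace_unitary_conj hU, h2]⟩
  rw [Matrix.conjTranspose_mul, Matrix.conjTranspose_mul, Matrix.conjTranspose_conjTranspose, h1,
    Matrix.neg_mul, Matrix.mul_neg, Matrix.mul_assoc]

/-- The exponential map of `SU(d)` is onto. The eigenvalue angles of `g` add up to a multiple of
`2π`, which is subtracted from one of them. -/
theorem exists_mem_su_exp_eq (hd : 0 < d) (g : SU d) :
    ∃ X ∈ su d, exp X = (g : Matrix (Fin d) (Fin d) ℂ) := by
  obtain ⟨U, hU, μ, hμ, hg⟩ := exists_unitary_diagonal (SU_mem_unitaryGroup g)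
  have hexp : ∀ j, Complex.exp (Complex.I * (Complex.arg (μ j) : ℂ)) = μ j := fun j => by
    have := Complex.norm_mul_exp_arg_mul_I (μ j)
    rwa [hμ, Complex.ofReal_one, one_mul, mul_comm] at this
  have hdet : ∏ j, μ j = 1 := by
    have : (g : Matrix (Fin d) (Fin d) ℂ).det = 1 := g.2.2
    rwa [hg, det_unitary_conj hU, Matrix.det_diagonal] at this
  obtain ⟨k, hk⟩ : ∃ k : ℤ, ∑ j, Complex.arg (μ j) = k * (2 * Real.pi) := by
    have h1 : Complex.exp (Complex.I * ((∑ j, Complex.arg (μ j) : ℝ) : ℂ)) = 1 := by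
      rw [Complex.ofReal_sum, Finset.mul_sum, Complex.exp_sum, Finset.prod_congr rfl
        fun j _ => hexp j, hdet]
    obtain ⟨k, hk⟩ := Complex.exp_eq_one_iff.1 h1
    refine ⟨k, ?_⟩
    have h2 := congrArg Complex.im hk
    simpa using h2
  let j₀ : Fin d := ⟨0, hd⟩
  let a : Fin d → ℝ := fun j => Complex.arg (μ j) - if j = j₀ then k * (2 * Real.pi) else 0
  have ha : ∑ j, a j = 0 := by
    simp only [a, Finset.sum_sub_distrib, hk, Finset.sum_ite_eq', Finset.mem_univ, if_true,
      sub_self]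
  refine ⟨_, unitary_conj_mem_su hU (diagonal_mem_su ha), ?_⟩
  rw [exp_unitary_conj hU, exp_diagonal_complex, hg]
  congr 3
  funext j
  simp only [a]
  by_cases hj : j = j₀
  · rw [if_pos hj, Complex.ofReal_sub, mul_sub, Complex.exp_sub, hexp]
    have : Complex.exp (Complex.I * ((k * (2 * Real.pi) : ℝ) : ℂ)) = 1 :=
      Complex.exp_eq_one_iff.2 ⟨k, by push_cast; ring⟩
    rw [this, div_one]
  · rw [if_neg hj, sub_zero, hexp]

instance : IsTopologicalGroup (SU d) where
  continuous_inv := Continuous.subtype_mk (continuous_subtype_val.star) _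

instance : CompactSpace (SU d) := by
  refine isCompact_iff_compactSpace.1 (Metric.isCompact_of_isClosed_isBounded ?_ ?_)
  · have e : (Matrix.specialUnitaryGroup (Fin d) ℂ : Set (Matrix (Fin d) (Fin d) ℂ)) =
        {A | A * star A = 1} ∩ {A | A.det = 1} := by
      ext A
      exact and_congr_left' Matrix.mem_unitaryGroup_iff
    rw [e]
    exact (isClosed_eq (by fun_prop) continuous_const).inter
      (isClosed_eq (Continuous.matrix_det continuous_id) continuous_const)
  · refine isBounded_iff_forall_norm_le.2 ⟨‖(1 : Matrix (Fin d) (Fin d) ℂ)‖, fun A hA => ?_⟩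
    rw [← Matrix.mul_one A, norm_unitary_mul hA.1]

/-- The generators of the one-parameter groups contained in `H`. They are taken among all complex
matrices; those that are skew-Hermitian lie in `𝔰𝔲(d)` by `trace_eq_zero_of_mem_oneParam`. -/
def oneParam (H : Subgroup (SU d)) : Set (Matrix (Fin d) (Fin d) ℂ) :=
  {X | ∀ t : ℝ, ∃ h ∈ H, (h : Matrix (Fin d) (Fin d) ℂ) = exp (t • X)}

theorem tendsto_inv_smul_exp_sub_one {ι : Type*} {l : Filter ι} (X : Matrix (Fin d) (Fin d) ℂ)
    {t : ι → ℝ} (ht : Tendsto t l (𝓝[≠] 0)) :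
    Tendsto (fun k => (t k)⁻¹ • (exp (t k • X) - 1)) l (𝓝 X) := by
  have h := hasDerivAt_exp_smul_const (𝕂 := ℝ) X (0 : ℝ)
  rw [hasDerivAt_iff_tendsto_slope] at h
  have h2 := h.comp ht
  simp only [slope_def_module, Function.comp_def, NormedSpace.exp_zero, sub_zero, zero_smul,
    one_mul] at h2
  exact h2

theorem conjTranspose_eq_neg_of_tendsto {h : ℕ → SU d} {t : ℕ → ℝ} (ht0 : ∀ k, 0 < t k)
    (ht : Tendsto t atTop (𝓝 0)) {X : Matrix (Fin d) (Fin d) ℂ}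
    (hX : Tendsto (fun k => (t k)⁻¹ • ((h k : Matrix (Fin d) (Fin d) ℂ) - 1)) atTop (𝓝 X)) :
    Xᴴ = -X := by
  -- `AᴴA + A + Aᴴ = 0` for `A = h - 1` with `h` unitary
  have e : ∀ k, t k • (((t k)⁻¹ • ((h k : Matrix (Fin d) (Fin d) ℂ) - 1))ᴴ *
      ((t k)⁻¹ • ((h k : Matrix (Fin d) (Fin d) ℂ) - 1))) +
      ((t k)⁻¹ • ((h k : Matrix (Fin d) (Fin d) ℂ) - 1)) +
      ((t k)⁻¹ • ((h k : Matrix (Fin d) (Fin d) ℂ) - 1))ᴴ = 0 := fun k => by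
    have hu : (h k : Matrix (Fin d) (Fin d) ℂ)ᴴ * (h k : Matrix (Fin d) (Fin d) ℂ) = 1 :=
      (SU_mem_unitaryGroup (h k)).1
    rw [Matrix.conjTranspose_smul, star_trivial, smul_mul_smul_comm, smul_smul, ← mul_assoc,
      mul_inv_cancel₀ (ht0 k).ne', one_mul, ← smul_add, ← smul_add]
    have : ((h k : Matrix (Fin d) (Fin d) ℂ) - 1)ᴴ * ((h k : Matrix (Fin d) (Fin d) ℂ) - 1) +
        ((h k : Matrix (Fin d) (Fin d) ℂ) - 1) + ((h k : Matrix (Fin d) (Fin d) ℂ) - 1)ᴴ = 0 := by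
      rw [Matrix.conjTranspose_sub, Matrix.conjTranspose_one, sub_mul, mul_sub, hu]
      noncomm_ring
    rw [this, smul_zero]
  have hX' := (continuous_id.matrix_conjTranspose.tendsto X).comp hX
  have hlim := ((ht.smul (hX'.mul hX)).add hX).add hX'
  have h0 := tendsto_nhds_unique (hlim.congr fun k => e k) tendsto_const_nhds
  simp only [id, zero_smul, zero_add] at h0
  exact eq_neg_of_add_eq_zero_right h0

/-- Sequential tangent directions of a closed subgroup at `1` generate one-parameter groups in it:
`exp (tX)` is the limit of the powers `hₖ ^ ⌊t / tₖ⌋`. -/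
theorem mem_oneParam_of_tendsto {H : Subgroup (SU d)} (hH : IsClosed (H : Set (SU d)))
    {h : ℕ → SU d} (hhH : ∀ k, h k ∈ H) {t : ℕ → ℝ} (ht0 : ∀ k, 0 < t k)
    (ht : Tendsto t atTop (𝓝 0)) {X : Matrix (Fin d) (Fin d) ℂ}
    (hX : Tendsto (fun k => (t k)⁻¹ • ((h k : Matrix (Fin d) (Fin d) ℂ) - 1)) atTop (𝓝 X)) :
    X ∈ oneParam H := by
  have hskew := conjTranspose_eq_neg_of_tendsto ht0 ht hX
  have hclosed : IsClosed (Subtype.val '' (H : Set (SU d)) : Set (Matrix (Fin d) (Fin d) ℂ)) :=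
    (hH.isCompact.image continuous_subtype_val).isClosed
  have htne : Tendsto t atTop (𝓝[≠] 0) :=
    tendsto_nhdsWithin_iff.2 ⟨ht, Eventually.of_forall fun k => (ht0 k).ne'⟩
  have hpos : ∀ s : ℝ, 0 ≤ s → ∃ g ∈ H, (g : Matrix (Fin d) (Fin d) ℂ) = exp (s • X) := by
    intro s hs
    set m : ℕ → ℕ := fun k => ⌊s / t k⌋₊ with hm
    have hmt_le : ∀ k, m k * t k ≤ s := fun k => by
      rw [← le_div_iff₀ (ht0 k)]
      exact Nat.floor_le (div_nonneg hs (ht0 k).le)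
    have hmt : Tendsto (fun k => m k * t k) atTop (𝓝 s) := by
      refine tendsto_of_tendsto_of_tendsto_of_le_of_le (g := fun k => s - t k) ?_ tendsto_const_nhds
        (fun k => ?_) hmt_le
      · simpa using tendsto_const_nhds.sub ht
      · have := Nat.lt_floor_add_one (s / t k)
        rw [div_lt_iff₀ (ht0 k)] at this
        simp only [hm]
        linarith
    have hexp : Tendsto (fun k => exp ((m k * t k) • X)) atTop (𝓝 (exp (s • X))) :=
      ((NormedSpace.exp_continuous (𝔸 := Matrix (Fin d) (Fin d) ℂ)).tendsto _).comp
        (hmt.smul_const X)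
    have hdiff : Tendsto (fun k => ((h k : Matrix (Fin d) (Fin d) ℂ)) ^ m k -
        exp ((m k * t k) • X)) atTop (𝓝 0) := by
      have hz : Tendsto (fun k => s * ‖(t k)⁻¹ • ((h k : Matrix (Fin d) (Fin d) ℂ) - 1) -
          (t k)⁻¹ • (exp (t k • X) - 1)‖) atTop (𝓝 0) := by
        simpa using ((hX.sub (tendsto_inv_smul_exp_sub_one X htne)).norm).const_mul s
      refine squeeze_zero_norm (fun k => ?_) hz
      have hsk : (t k • X)ᴴ = -(t k • X) := by
        rw [Matrix.conjTranspose_smul, star_trivial, hskew, smul_neg]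
      have e1 : exp ((m k * t k) • X) = exp (t k • X) ^ m k := by
        rw [← Matrix.exp_nsmul, mul_smul, Nat.cast_smul_eq_nsmul]
      rw [e1, ← smul_sub, sub_sub_sub_cancel_right, norm_smul, norm_inv,
        Real.norm_of_nonneg (ht0 k).le]
      refine (norm_pow_sub_pow_le (SU_mem_unitaryGroup (h k))
        (exp_mem_unitaryGroup_of_skew hsk) (m k)).trans ?_
      rw [← mul_assoc]
      refine mul_le_mul_of_nonneg_right ?_ (norm_nonneg _)
      rw [← div_eq_mul_inv, le_div_iff₀ (ht0 k)]
      exact hmt_le k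
    have hlim : Tendsto (fun k => ((h k ^ m k : SU d) : Matrix (Fin d) (Fin d) ℂ)) atTop
        (𝓝 (exp (s • X))) := by
      have := hdiff.add hexp
      simpa using this
    obtain ⟨g, hg, hgX⟩ := hclosed.mem_of_tendsto hlim
      (Eventually.of_forall fun k => ⟨_, H.pow_mem (hhH k) _, rfl⟩)
    exact ⟨g, hg, hgX⟩
  intro s
  rcases le_total 0 s with hs | hs
  · exact hpos s hs
  · obtain ⟨g, hg, hgX⟩ := hpos (-s) (by linarith)
    refine ⟨g⁻¹, H.inv_mem hg, ?_⟩
    rw [coe_inv_SU, hgX, ← Matrix.exp_conjTranspose, Matrix.conjTranspose_smul, hskew]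
    simp

theorem trace_eq_zero_of_mem_oneParam {H : Subgroup (SU d)} {X : Matrix (Fin d) (Fin d) ℂ}
    (hskew : Xᴴ = -X) (hX : X ∈ oneParam H) : X.trace = 0 := by
  have h1 : ∀ t : ℝ, Complex.exp (t * X.trace) = 1 := fun t => by
    obtain ⟨h, -, hh⟩ := hX t
    have hsk : (t • X)ᴴ = -(t • X) := by
      rw [Matrix.conjTranspose_smul, star_trivial, hskew, smul_neg]
    have : (h : Matrix (Fin d) (Fin d) ℂ).det = 1 := h.2.2
    rw [hh, det_exp_of_skew hsk, Matrix.trace_smul] at this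
    simpa using this
  have h2 : HasDerivAt (fun t : ℝ => Complex.exp (t * X.trace)) X.trace 0 := by
    have := ((Complex.ofRealCLM.hasDerivAt (x := 0)).mul_const X.trace).cexp
    simpa using this
  rw [funext h1] at h2
  exact h2.unique (hasDerivAt_const 0 1)

theorem add_mem_oneParam {H : Subgroup (SU d)} (hH : IsClosed (H : Set (SU d)))
    {X Y : Matrix (Fin d) (Fin d) ℂ} (hX : X ∈ oneParam H) (hY : Y ∈ oneParam H) :
    X + Y ∈ oneParam H := by
  set t : ℕ → ℝ := fun k => 1 / ((k : ℝ) + 1) with ht_def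
  have ht0 : ∀ k, 0 < t k := fun k => Nat.one_div_pos_of_nat
  have ht : Tendsto t atTop (𝓝 0) := tendsto_one_div_add_atTop_nhds_zero_nat
  have htne : Tendsto t atTop (𝓝[≠] 0) :=
    tendsto_nhdsWithin_iff.2 ⟨ht, Eventually.of_forall fun k => (ht0 k).ne'⟩
  choose x hx hxX using fun k => hX (t k)
  choose y hy hyY using fun k => hY (t k)
  refine mem_oneParam_of_tendsto hH (h := fun k => x k * y k) (fun k => H.mul_mem (hx k) (hy k))
    ht0 ht ?_
  have e : ∀ k, (t k)⁻¹ • (((x k * y k : SU d) : Matrix (Fin d) (Fin d) ℂ) - 1) =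
      (t k)⁻¹ • (exp (t k • X) - 1) * exp (t k • Y) + (t k)⁻¹ • (exp (t k • Y) - 1) := fun k => by
    rw [Submonoid.coe_mul, hxX, hyY, smul_mul_assoc, ← smul_add]
    congr 1
    noncomm_ring
  have h1 : Tendsto (fun k => exp (t k • Y)) atTop (𝓝 1) := by
    have := ((NormedSpace.exp_continuous (𝔸 := Matrix (Fin d) (Fin d) ℂ)).tendsto _).comp
      (ht.smul_const Y)
    rw [zero_smul, NormedSpace.exp_zero] at this
    exact this
  have h2 := ((tendsto_inv_smul_exp_sub_one X htne).mul h1).add (tendsto_inv_smul_exp_sub_one Y htne)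
  rw [mul_one] at h2
  exact h2.congr fun k => (e k).symm

/-- The Lie algebra of a closed subgroup of `SU(d)`, as a real subspace of `𝔰𝔲(d)`. -/
def tangentSpace (H : Subgroup (SU d)) (hH : IsClosed (H : Set (SU d))) : Submodule ℝ (su d) where
  carrier := {X | (X : Matrix (Fin d) (Fin d) ℂ) ∈ oneParam H}
  add_mem' hX hY := add_mem_oneParam hH hX hY
  zero_mem' t := ⟨1, H.one_mem, by simp [NormedSpace.exp_zero]⟩
  smul_mem' r X hX t := by
    obtain ⟨h, hh, e⟩ := hX (t * r)
    exact ⟨h, hh, by rw [e, mul_smul]; rfl⟩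

theorem Ad_apply_coe (g : SU d) (X : su d) :
    (Ad d g X : Matrix (Fin d) (Fin d) ℂ) = 
      (g : Matrix (Fin d) (Fin d) ℂ) * (X : Matrix (Fin d) (Fin d) ℂ) *
        (g : Matrix (Fin d) (Fin d) ℂ)ᴴ := rfl

theorem Ad_mem_tangentSpace {H : Subgroup (SU d)} (hH : IsClosed (H : Set (SU d))) {g : SU d}
    (hg : g ∈ H) {X : su d} (hX : X ∈ tangentSpace H hH) : Ad d g X ∈ tangentSpace H hH := by
  intro t
  obtain ⟨h, hh, e⟩ := hX t
  refine ⟨g * h * g⁻¹, H.mul_mem (H.mul_mem hg hh) (H.inv_mem hg), ?_⟩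
  rw [Ad_apply_coe, ← smul_mul_assoc, ← mul_smul_comm, exp_unitary_conj (SU_mem_unitaryGroup g), ← e]
  rfl

/-- The identity is not isolated in an infinite closed subgroup, by compactness. -/
theorem exists_ne_one_norm_lt {H : Subgroup (SU d)} (hH : IsClosed (H : Set (SU d)))
    (hinf : Infinite H) {ε : ℝ} (hε : 0 < ε) :
    ∃ h ∈ H, h ≠ 1 ∧ ‖(h : Matrix (Fin d) (Fin d) ℂ) - 1‖ < ε := by
  by_contra! hcon
  have : CompactSpace H := isCompact_iff_compactSpace.1 hH.isCompact
  have hopen : IsOpen ({1} : Set H) := by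
    have hc : Continuous fun h : H => ‖((h : SU d) : Matrix (Fin d) (Fin d) ℂ) - 1‖ :=
      ((continuous_subtype_val.comp continuous_subtype_val).sub continuous_const).norm
    convert (isOpen_Iio (a := ε)).preimage hc using 1
    ext h
    simp only [Set.mem_singleton_iff, Set.mem_preimage, Set.mem_Iio]
    constructor
    · rintro rfl
      simpa using hε
    · intro hlt
      by_contra hne
      exact absurd hlt (not_lt.2 (hcon h h.2 fun h1 => hne (Subtype.ext h1)))
  have := discreteTopology_of_isOpen_singleton_one hopen
  exact not_finite_iff_infinite.2 hinf finite_of_compact_of_discrete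

/-- An infinite closed subgroup of `SU(d)` contains a nontrivial one-parameter group. -/
theorem tangentSpace_ne_bot {H : Subgroup (SU d)} (hH : IsClosed (H : Set (SU d)))
    (hinf : Infinite H) : tangentSpace H hH ≠ ⊥ := by
  choose h hhH hne hlt using fun k : ℕ =>
    exists_ne_one_norm_lt hH hinf (Nat.one_div_pos_of_nat (α := ℝ) (n := k))
  set t : ℕ → ℝ := fun k => ‖(h k : Matrix (Fin d) (Fin d) ℂ) - 1‖ with ht_def
  have ht0 : ∀ k, 0 < t k := fun k => norm_pos_iff.2 (sub_ne_zero.2 fun e => hne k (Subtype.ext e))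
  have ht : Tendsto t atTop (𝓝 0) :=
    squeeze_zero (fun k => (ht0 k).le) (fun k => (hlt k).le) tendsto_one_div_add_atTop_nhds_zero_nat
  have hsph : ∀ k, (t k)⁻¹ • ((h k : Matrix (Fin d) (Fin d) ℂ) - 1) ∈
      Metric.sphere (0 : Matrix (Fin d) (Fin d) ℂ) 1 := fun k => by
    rw [mem_sphere_zero_iff_norm, norm_smul, norm_inv, Real.norm_of_nonneg (ht0 k).le]
    exact inv_mul_cancel₀ (ht0 k).ne'
  obtain ⟨X, hX1, φ, hφ, hX⟩ := (isCompact_sphere _ _).tendsto_subseq hsph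
  have ht' := ht.comp hφ.tendsto_atTop
  have hmem : X ∈ oneParam H :=
    mem_oneParam_of_tendsto hH (h := h ∘ φ) (t := t ∘ φ) (fun k => hhH _) (fun k => ht0 _) ht' hX
  have hskew : Xᴴ = -X :=
    conjTranspose_eq_neg_of_tendsto (h := h ∘ φ) (t := t ∘ φ) (fun k => ht0 _) ht' hX
  have hXsu : X ∈ su d := ⟨hskew, trace_eq_zero_of_mem_oneParam hskew hmem⟩
  intro hbot
  have h0 : (⟨X, hXsu⟩ : su d) ∈ tangentSpace H hH := hmem
  rw [hbot, Submodule.mem_bot] at h0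
  have : X = 0 := congrArg Subtype.val h0
  rw [this] at hX1
  simp at hX1

theorem eq_top_of_tangentSpace_eq_top (hd : 0 < d) {H : Subgroup (SU d)}
    (hH : IsClosed (H : Set (SU d))) (htop : tangentSpace H hH = ⊤) : H = ⊤ := by
  rw [eq_top_iff]
  intro g _
  obtain ⟨X, hX, hXg⟩ := exists_mem_su_exp_eq hd g
  have hmem : (⟨X, hX⟩ : su d) ∈ tangentSpace H hH := htop ▸ Submodule.mem_top
  obtain ⟨h, hh, e⟩ := hmem 1
  rw [one_smul, hXg] at e
  rwa [← Subtype.ext e]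

/-! ### Finite subgroups, and invariant subspaces of the adjoint representation -/

theorem center_coe_comm {c : SU d} (hc : c ∈ Subgroup.center (SU d)) (g : SU d) :
    (g : Matrix (Fin d) (Fin d) ℂ) * (c : Matrix (Fin d) (Fin d) ℂ) =
      (c : Matrix (Fin d) (Fin d) ℂ) * (g : Matrix (Fin d) (Fin d) ℂ) :=
  congrArg Subtype.val (Subgroup.mem_center_iff.1 hc g)

theorem norm_coe_mul (g : SU d) (A : Matrix (Fin d) (Fin d) ℂ) :
    ‖(g : Matrix (Fin d) (Fin d) ℂ) * A‖ = ‖A‖ :=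
  norm_unitary_mul (SU_mem_unitaryGroup g) A

theorem norm_mul_coe (g : SU d) (A : Matrix (Fin d) (Fin d) ℂ) :
    ‖A * (g : Matrix (Fin d) (Fin d) ℂ)‖ = ‖A‖ :=
  norm_mul_unitary (SU_mem_unitaryGroup g) A

theorem coe_mul_coe_inv (g : SU d) :
    (g : Matrix (Fin d) (Fin d) ℂ) * ((g⁻¹ : SU d) : Matrix (Fin d) (Fin d) ℂ) = 1 :=
  congrArg Subtype.val (mul_inv_cancel g)

theorem coe_inv_mul_coe (g : SU d) :
    ((g⁻¹ : SU d) : Matrix (Fin d) (Fin d) ℂ) * (g : Matrix (Fin d) (Fin d) ℂ) = 1 :=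
  congrArg Subtype.val (inv_mul_cancel g)

/-- Group commutators contract towards `1`, at a rate governed by the distances to the center. -/
theorem norm_commutator_sub_one_le {c₁ c : SU d} (hc₁ : c₁ ∈ Subgroup.center (SU d))
    (hc : c ∈ Subgroup.center (SU d)) (g x : SU d) :
    ‖((g * x * g⁻¹ * x⁻¹ : SU d) : Matrix (Fin d) (Fin d) ℂ) - 1‖ ≤
      √2 * ‖(g : Matrix (Fin d) (Fin d) ℂ) - c₁‖ * ‖(x : Matrix (Fin d) (Fin d) ℂ) - c‖ := by
  set g' : SU d := c₁⁻¹ * g with hg'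
  have hg : g = c₁ * g' := by rw [hg', mul_inv_cancel_left]
  clear_value g'
  have e1 : ‖((g * x * g⁻¹ * x⁻¹ : SU d) : Matrix (Fin d) (Fin d) ℂ) - 1‖ =
      ‖((g * x : SU d) : Matrix (Fin d) (Fin d) ℂ) -
        ((x * g : SU d) : Matrix (Fin d) (Fin d) ℂ)‖ := by
    have : g * x * g⁻¹ * x⁻¹ * (x * g) = g * x := by group
    rw [← norm_mul_coe (x * g), sub_mul, one_mul, ← Submonoid.coe_mul, this]
  have e2 : ((g * x : SU d) : Matrix (Fin d) (Fin d) ℂ) -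
        ((x * g : SU d) : Matrix (Fin d) (Fin d) ℂ) =
      (c₁ : Matrix (Fin d) (Fin d) ℂ) * ((g' : Matrix (Fin d) (Fin d) ℂ) *
        ((x : Matrix (Fin d) (Fin d) ℂ) - c) -
        ((x : Matrix (Fin d) (Fin d) ℂ) - c) * g') := by
    have h1 : x * g = c₁ * (x * g') := by
      rw [hg, ← mul_assoc, Subgroup.mem_center_iff.1 hc₁ x, mul_assoc]
    rw [h1, hg, mul_assoc, Submonoid.coe_mul, Submonoid.coe_mul, Submonoid.coe_mul,
      Submonoid.coe_mul, ← mul_sub]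
    congr 1
    rw [mul_sub, sub_mul, center_coe_comm hc]
    abel
  have e3 : ‖(g : Matrix (Fin d) (Fin d) ℂ) - c₁‖ = ‖(g' : Matrix (Fin d) (Fin d) ℂ) - 1‖ := by
    rw [← norm_coe_mul c₁ ((g' : Matrix (Fin d) (Fin d) ℂ) - 1), mul_sub, mul_one, hg,
      Submonoid.coe_mul]
  rw [e1, e2, norm_coe_mul, e3]
  exact norm_commutator_le (SU_mem_unitaryGroup g') _

/-- If `k = g x g⁻¹ x⁻¹` commutes with `g`, then `kⁿ x = gⁿ x g⁻ⁿ` stays at distance `‖x - c‖ < 1`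
from the central element `c`. Averaging over `n` shows that `1` is the only eigenvalue of `k`. -/
theorem commutator_eq_one_of_commute {c g x : SU d} (hc : c ∈ Subgroup.center (SU d))
    (hx : ‖(x : Matrix (Fin d) (Fin d) ℂ) - c‖ < 1) (hfin : IsOfFinOrder (g * x * g⁻¹ * x⁻¹))
    (hcomm : Commute g (g * x * g⁻¹ * x⁻¹)) : g * x * g⁻¹ * x⁻¹ = 1 := by
  set k := g * x * g⁻¹ * x⁻¹ with hk
  have hkx : g * x * g⁻¹ = k * x := by rw [hk, inv_mul_cancel_right]
  clear_value k
  have hpow : ∀ n : ℕ, g ^ n * x * (g ^ n)⁻¹ = k ^ n * x := by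
    intro n
    induction n with
    | zero => simp
    | succ n ih =>
      calc g ^ (n + 1) * x * (g ^ (n + 1))⁻¹ = g * (g ^ n * x * (g ^ n)⁻¹) * g⁻¹ := by
            rw [pow_succ']; group
        _ = k ^ n * (g * x * g⁻¹) := by
            rw [ih, ← mul_assoc, (hcomm.pow_right n).eq]; simp only [mul_assoc]
        _ = k ^ (n + 1) * x := by rw [hkx, pow_succ, mul_assoc]
  have hnorm : ∀ n : ℕ, ‖(k : Matrix (Fin d) (Fin d) ℂ) ^ n * x - c‖ =
      ‖(x : Matrix (Fin d) (Fin d) ℂ) - c‖ := by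
    intro n
    have h1 : (k : Matrix (Fin d) (Fin d) ℂ) ^ n * x =
        ((g ^ n : SU d) : Matrix (Fin d) (Fin d) ℂ) * x *
          (((g ^ n)⁻¹ : SU d) : Matrix (Fin d) (Fin d) ℂ) := by
      have := congrArg Subtype.val (hpow n)
      exact this.symm
    have h2 : (c : Matrix (Fin d) (Fin d) ℂ) =
        ((g ^ n : SU d) : Matrix (Fin d) (Fin d) ℂ) * c *
          (((g ^ n)⁻¹ : SU d) : Matrix (Fin d) (Fin d) ℂ) := by
      rw [center_coe_comm hc, mul_assoc, coe_mul_coe_inv, mul_one]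
    rw [h1]
    conv_lhs => rw [h2]
    rw [← sub_mul, ← mul_sub, norm_mul_coe, norm_coe_mul]
  obtain ⟨N, hN, hkN⟩ := isOfFinOrder_iff_pow_eq_one.1 hfin
  have hkN' : (k : Matrix (Fin d) (Fin d) ℂ) ^ N = 1 := congrArg Subtype.val hkN
  set P : Matrix (Fin d) (Fin d) ℂ := ∑ n ∈ Finset.range N, (k : Matrix (Fin d) (Fin d) ℂ) ^ n
    with hP
  -- `(k - 1) P = 0`, while `P x` is at distance less than `N` from `N c`
  have hkP : ((k : Matrix (Fin d) (Fin d) ℂ) - 1) * P = 0 := by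
    rw [hP, mul_geom_sum, hkN', sub_self]
  have hPx : ‖P * x - (N : ℝ) • (c : Matrix (Fin d) (Fin d) ℂ)‖ ≤
      N * ‖(x : Matrix (Fin d) (Fin d) ℂ) - c‖ := by
    have e : P * x - (N : ℝ) • (c : Matrix (Fin d) (Fin d) ℂ) =
        ∑ n ∈ Finset.range N, ((k : Matrix (Fin d) (Fin d) ℂ) ^ n * x - c) := by
      rw [Finset.sum_sub_distrib, hP, Finset.sum_mul, Finset.sum_const, Finset.card_range,
        Nat.cast_smul_eq_nsmul]
    rw [e]
    refine (norm_sum_le _ _).trans ?_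
    simp [hnorm]
  by_contra hne
  have hpos : 0 < ‖(k : Matrix (Fin d) (Fin d) ℂ) - 1‖ :=
    norm_pos_iff.2 (sub_ne_zero.2 fun e => hne (Subtype.ext e))
  have hNpos : (0 : ℝ) < N := by exact_mod_cast hN
  have h3 : N * ‖(k : Matrix (Fin d) (Fin d) ℂ) - 1‖ ≤
      ‖(k : Matrix (Fin d) (Fin d) ℂ) - 1‖ * (N * ‖(x : Matrix (Fin d) (Fin d) ℂ) - c‖) := by
    calc N * ‖(k : Matrix (Fin d) (Fin d) ℂ) - 1‖
        = ‖((k : Matrix (Fin d) (Fin d) ℂ) - 1) * (P * x - (N : ℝ) • (c : Matrix (Fin d) (Fin d) ℂ))‖ := by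
          rw [mul_sub, ← mul_assoc, hkP, zero_mul, zero_sub, norm_neg, mul_smul_comm, norm_smul,
            norm_mul_coe, Real.norm_natCast]
      _ ≤ _ := (norm_mul_le _ _).trans (by gcongr)
  nlinarith [mul_pos hNpos hpos]

theorem isOfFinOrder_of_mem_finite_subgroup {G : Type*} [Group G] {H : Subgroup G} [Finite H] {k : G}
    (hk : k ∈ H) : IsOfFinOrder k :=
  H.subtype.isOfFinOrder (isOfFinOrder_of_finite (⟨k, hk⟩ : H))

/-- In a finite subgroup, elements at Frobenius distance less than `1/√2` from the center commute. -/
theorem mul_comm_of_mem_nearCenter {H : Subgroup (SU d)} [Finite H] {g h : SU d} (hg : g ∈ H)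
    (hh : h ∈ H) (hgB : g ∈ nearCenter d) (hhB : h ∈ nearCenter d) : g * h = h * g := by
  obtain ⟨c₁, hc₁, hg1⟩ := hgB
  obtain ⟨c₂, hc₂, hh1⟩ := hhB
  rw [frobeniusNorm_eq_norm] at hg1 hh1
  have hs : (0 : ℝ) < √2 := by positivity
  have hq : √2 * ‖(g : Matrix (Fin d) (Fin d) ℂ) - c₁‖ < 1 := by
    rw [lt_div_iff₀ hs] at hg1
    linarith
  -- a non-commuting partner `x` of `g` close to the center, with `g x g⁻¹ x⁻¹` closest to `1`
  by_contra hne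
  set T : Set (SU d) := {x | x ∈ H ∧ (∃ c ∈ Subgroup.center (SU d),
    ‖(x : Matrix (Fin d) (Fin d) ℂ) - c‖ < 1) ∧ g * x * g⁻¹ * x⁻¹ ≠ 1} with hT
  have hTfin : T.Finite := (Set.toFinite (H : Set (SU d))).subset fun x hx => hx.1
  have hTne : T.Nonempty := by
    refine ⟨h, hh, ⟨c₂, hc₂, hh1.trans ?_⟩, fun h1 => hne ?_⟩
    · rw [div_lt_one hs]
      exact Real.lt_sqrt_of_sq_lt (by norm_num)
    · rwa [mul_inv_eq_one, mul_inv_eq_iff_eq_mul] at h1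
  obtain ⟨x, ⟨hxH, ⟨c, hc, hxc⟩, hx1⟩, hmin⟩ := hTfin.exists_minimalFor
    (fun x => ‖((g * x * g⁻¹ * x⁻¹ : SU d) : Matrix (Fin d) (Fin d) ℂ) - 1‖) T hTne
  set k := g * x * g⁻¹ * x⁻¹ with hk
  have hkH : k ∈ H := H.mul_mem (H.mul_mem (H.mul_mem hg hxH) (H.inv_mem hg)) (H.inv_mem hxH)
  have hkpos : 0 < ‖(k : Matrix (Fin d) (Fin d) ℂ) - 1‖ :=
    norm_pos_iff.2 (sub_ne_zero.2 fun e => hx1 (Subtype.ext e))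
  have hk1 : ‖(k : Matrix (Fin d) (Fin d) ℂ) - 1‖ < 1 := by
    have := norm_commutator_sub_one_le hc₁ hc g x
    nlinarith [norm_nonneg ((x : Matrix (Fin d) (Fin d) ℂ) - c)]
  have hcomm : g * k * g⁻¹ * k⁻¹ = 1 := by
    by_contra hgk
    have hkT : k ∈ T := ⟨hkH, ⟨1, Subgroup.one_mem _, hk1⟩, hgk⟩
    have h1 := norm_commutator_sub_one_le hc₁ (Subgroup.one_mem (Subgroup.center (SU d))) g k
    have h2 : ‖((g * k * g⁻¹ * k⁻¹ : SU d) : Matrix (Fin d) (Fin d) ℂ) - 1‖ <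
        ‖(k : Matrix (Fin d) (Fin d) ℂ) - 1‖ :=
      h1.trans_lt (mul_lt_of_lt_one_left hkpos hq)
    exact absurd (hmin hkT h2.le) (not_le.2 h2)
  rw [mul_inv_eq_one, mul_inv_eq_iff_eq_mul] at hcomm
  have hfin : IsOfFinOrder k := isOfFinOrder_of_mem_finite_subgroup hkH
  exact hx1 (commutator_eq_one_of_commute hc hxc hfin hcomm)

theorem traceless_part_mem_su (hd : 0 < d) {Y : Matrix (Fin d) (Fin d) ℂ} (hY : Yᴴ = -Y) :
    Y - (Y.trace / d) • (1 : Matrix (Fin d) (Fin d) ℂ) ∈ su d := by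
  have hd' : (d : ℂ) ≠ 0 := by exact_mod_cast hd.ne'
  constructor
  · have ht : star Y.trace = -Y.trace := by
      rw [← Matrix.trace_conjTranspose, hY, Matrix.trace_neg]
    rw [Matrix.conjTranspose_sub, Matrix.conjTranspose_smul, Matrix.conjTranspose_one, hY, star_div₀,
      ht, star_natCast, neg_div, neg_smul]
    abel
  · rw [Matrix.trace_sub, Matrix.trace_smul, Matrix.trace_one, Fintype.card_fin, smul_eq_mul,
      div_mul_cancel₀ _ hd', sub_self]

theorem mem_center_of_eq_smul_one {h : SU d} {s : ℂ} (hs : (h : Matrix (Fin d) (Fin d) ℂ) = s • 1) :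
    h ∈ Subgroup.center (SU d) := by
  refine Subgroup.mem_center_iff.2 fun g => Subtype.ext ?_
  rw [Submonoid.coe_mul, Submonoid.coe_mul, hs]
  simp

theorem mem_center_of_commute_su (hd : 0 < d) {h : SU d}
    (hcomm : ∀ X ∈ su d, (h : Matrix (Fin d) (Fin d) ℂ) * X = X * (h : Matrix (Fin d) (Fin d) ℂ)) :
    h ∈ Subgroup.center (SU d) := by
  refine Subgroup.mem_center_iff.2 fun g => Subtype.ext ?_
  obtain ⟨X, hX, hXg⟩ := exists_mem_su_exp_eq hd g
  rw [Submonoid.coe_mul, Submonoid.coe_mul, ← hXg]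
  have h1 : Commute (h : Matrix (Fin d) (Fin d) ℂ) X := hcomm X hX
  exact (h1.exp_right).eq.symm

/-- The subspace of `𝔰𝔲(d)` fixed by all elements of `H` near the center. -/
def fixedNearCenter (H : Subgroup (SU d)) : Submodule ℝ (su d) where
  carrier := {X | ∀ k ∈ H, k ∈ nearCenter d →
    (k : Matrix (Fin d) (Fin d) ℂ) * (X : Matrix (Fin d) (Fin d) ℂ) =
      (X : Matrix (Fin d) (Fin d) ℂ) * (k : Matrix (Fin d) (Fin d) ℂ)}
  add_mem' hX hY k hk hkB := by
    change _ * (_ + _) = (_ + _) * _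
    rw [mul_add, add_mul, hX k hk hkB, hY k hk hkB]
  zero_mem' k hk hkB := by
    change _ * (0 : Matrix (Fin d) (Fin d) ℂ) = 0 * _
    rw [mul_zero, zero_mul]
  smul_mem' r X hX k hk hkB := by
    change _ * (r • _) = (r • _) * _
    rw [mul_smul_comm, smul_mul_assoc, hX k hk hkB]

theorem conj_mem_nearCenter {k : SU d} (hk : k ∈ nearCenter d) (g : SU d) :
    g⁻¹ * k * g ∈ nearCenter d := by
  obtain ⟨c, hc, h⟩ := hk
  refine ⟨c, hc, ?_⟩
  rw [frobeniusNorm_eq_norm] at h ⊢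
  have e : ((g⁻¹ * k * g : SU d) : Matrix (Fin d) (Fin d) ℂ) - c =
      ((g⁻¹ : SU d) : Matrix (Fin d) (Fin d) ℂ) * ((k : Matrix (Fin d) (Fin d) ℂ) - c) * g := by
    rw [mul_sub, sub_mul, Submonoid.coe_mul, Submonoid.coe_mul, center_coe_comm hc,
      mul_assoc (c : Matrix (Fin d) (Fin d) ℂ), coe_inv_mul_coe, mul_one]
  rwa [e, norm_mul_coe, norm_coe_mul]

theorem Ad_mem_fixedNearCenter {H : Subgroup (SU d)} {g : SU d} (hg : g ∈ H) {X : su d}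
    (hX : X ∈ fixedNearCenter H) : Ad d g X ∈ fixedNearCenter H := by
  intro k hk hkB
  have h1 := hX (g⁻¹ * k * g) (H.mul_mem (H.mul_mem (H.inv_mem hg) hk) hg)
    (conj_mem_nearCenter hkB g)
  rw [Submonoid.coe_mul, Submonoid.coe_mul] at h1
  rw [Ad_apply_coe, ← coe_inv_SU]
  generalize (X : Matrix (Fin d) (Fin d) ℂ) = Y at *
  have h2 := congrArg (fun Z => (g : Matrix (Fin d) (Fin d) ℂ) * Z *
    ((g⁻¹ : SU d) : Matrix (Fin d) (Fin d) ℂ)) h1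
  simp only [← mul_assoc, coe_mul_coe_inv, one_mul] at h2
  rw [mul_assoc _ (g : Matrix (Fin d) (Fin d) ℂ) ((g⁻¹ : SU d) : Matrix (Fin d) (Fin d) ℂ),
    coe_mul_coe_inv, mul_one] at h2
  rw [← mul_assoc, ← mul_assoc, h2]

/-- If the near-center elements of `H` commute with each other and their common fixed space is `0` or
`𝔰𝔲(d)`, then they are central. The fixed space contains the traceless skew-Hermitian parts of `h`
and `ih` for each of them. -/
theorem subset_center_of_fixedNearCenter (hd : 0 < d) {H : Subgroup (SU d)}
    (hcomm : ∀ g ∈ H, ∀ h ∈ H, g ∈ nearCenter d → h ∈ nearCenter d → g * h = h * g)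
    (hV : fixedNearCenter H = ⊥ ∨ fixedNearCenter H = ⊤) :
    (H : Set (SU d)) ∩ nearCenter d ⊆ (Subgroup.center (SU d) : Set (SU d)) := by
  rintro h ⟨hh, hhB⟩
  rcases hV with hV | hV
  · have hmul : ∀ k ∈ H, k ∈ nearCenter d →
        Commute (k : Matrix (Fin d) (Fin d) ℂ) (h : Matrix (Fin d) (Fin d) ℂ) ∧
        Commute (k : Matrix (Fin d) (Fin d) ℂ) (h : Matrix (Fin d) (Fin d) ℂ)ᴴ := by
      intro k hk hkB
      have h1 : Commute k h := hcomm k hk h hh hkB hhB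
      exact ⟨congrArg Subtype.val h1.eq, congrArg Subtype.val h1.inv_right.eq⟩
    -- a traceless skew-Hermitian matrix in the algebra generated by `h` and `hᴴ` vanishes
    have key : ∀ Y : Matrix (Fin d) (Fin d) ℂ, Yᴴ = -Y →
        (∀ k ∈ H, k ∈ nearCenter d → Commute (k : Matrix (Fin d) (Fin d) ℂ) Y) →
        ∃ s : ℂ, Y = s • 1 := by
      intro Y hY hYc
      have hmem : (⟨_, traceless_part_mem_su hd hY⟩ : su d) ∈ fixedNearCenter H := by
        intro k hk hkB
        change _ * (Y - _) = (Y - _) * _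
        rw [mul_sub, sub_mul, (hYc k hk hkB).eq]
        simp
      rw [hV, Submodule.mem_bot] at hmem
      exact ⟨_, sub_eq_zero.1 (congrArg Subtype.val hmem)⟩
    obtain ⟨a, ha⟩ := key ((h : Matrix (Fin d) (Fin d) ℂ) - (h : Matrix (Fin d) (Fin d) ℂ)ᴴ)
      (by simp) (fun k hk hkB => (hmul k hk hkB).1.sub_right (hmul k hk hkB).2)
    obtain ⟨b, hb⟩ := key
      (Complex.I • ((h : Matrix (Fin d) (Fin d) ℂ) + (h : Matrix (Fin d) (Fin d) ℂ)ᴴ))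
      (by simp [add_comm])
      (fun k hk hkB => ((hmul k hk hkB).1.add_right (hmul k hk hkB).2).smul_right _)
    refine mem_center_of_eq_smul_one (s := (a - Complex.I * b) / 2) ?_
    have e : (h : Matrix (Fin d) (Fin d) ℂ) = (1 / 2 : ℂ) •
        (((h : Matrix (Fin d) (Fin d) ℂ) - (h : Matrix (Fin d) (Fin d) ℂ)ᴴ) - Complex.I •
          (Complex.I • ((h : Matrix (Fin d) (Fin d) ℂ) + (h : Matrix (Fin d) (Fin d) ℂ)ᴴ))) := by
      rw [smul_smul, Complex.I_mul_I]
      module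
    rw [e, ha, hb]
    module
  · refine mem_center_of_commute_su hd fun X hX => ?_
    have hmem : (⟨X, hX⟩ : su d) ∈ fixedNearCenter H := hV ▸ Submodule.mem_top
    exact hmem h hh hhB

/-- The inner product `Re tr (Xᴴ Y)` on `𝔰𝔲(d)`. -/
noncomputable def frobeniusForm (d : ℕ) : LinearMap.BilinForm ℝ (su d) :=
  LinearMap.mk₂ ℝ (fun X Y =>
      ((X : Matrix (Fin d) (Fin d) ℂ)ᴴ * (Y : Matrix (Fin d) (Fin d) ℂ)).trace.re)
    (fun X₁ X₂ Y => by
      change ((_ + _ : Matrix (Fin d) (Fin d) ℂ)ᴴ * _).trace.re = _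
      rw [Matrix.conjTranspose_add, add_mul, Matrix.trace_add, Complex.add_re])
    (fun r X Y => by
      change ((r • _ : Matrix (Fin d) (Fin d) ℂ)ᴴ * _).trace.re = _
      rw [Matrix.conjTranspose_smul, smul_mul_assoc, Matrix.trace_smul, star_trivial,
        Complex.smul_re])
    (fun X Y₁ Y₂ => by
      change (_ * (_ + _ : Matrix (Fin d) (Fin d) ℂ)).trace.re = _
      rw [mul_add, Matrix.trace_add, Complex.add_re])
    (fun r X Y => by
      change (_ * (r • _ : Matrix (Fin d) (Fin d) ℂ)).trace.re = _
      rw [mul_smul_comm, Matrix.trace_smul, Complex.smul_re])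

theorem frobeniusForm_apply (X Y : su d) : frobeniusForm d X Y =
    ((X : Matrix (Fin d) (Fin d) ℂ)ᴴ * (Y : Matrix (Fin d) (Fin d) ℂ)).trace.re := rfl

theorem frobeniusForm_isSymm : (frobeniusForm d).IsSymm := by
  refine ⟨fun X Y => ?_⟩
  rw [frobeniusForm_apply, frobeniusForm_apply, ← Complex.conj_re,
    ← Complex.star_def, ← Matrix.trace_conjTranspose, Matrix.conjTranspose_mul,
    Matrix.conjTranspose_conjTranspose]

theorem frobeniusForm_Ad (g : SU d) (X Y : su d) :
    frobeniusForm d X (Ad d g Y) = frobeniusForm d (Ad d g⁻¹ X) Y := by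
  rw [frobeniusForm_apply, frobeniusForm_apply, Ad_apply_coe, Ad_apply_coe, coe_inv_SU,
    Matrix.conjTranspose_conjTranspose, Matrix.conjTranspose_mul, Matrix.conjTranspose_mul,
    Matrix.conjTranspose_conjTranspose, Matrix.trace_mul_comm, Matrix.mul_assoc, Matrix.trace_mul_comm]
  simp only [Matrix.mul_assoc]

/-- If only the scalars commute with `Ad_S`, then `Ad` restricted to a subgroup containing `S` is
irreducible: the orthogonal projection onto an invariant subspace is a scalar. -/
theorem eq_bot_or_eq_top_of_commutantAd {S : Set (SU d)}
    (hS : commutantAd S = {A | ∃ r : ℝ, A = r • (1 : Module.End ℝ (su d))})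
    {H : Subgroup (SU d)} (hSH : S ⊆ H) (V : Submodule ℝ (su d))
    (hV : ∀ g ∈ H, ∀ X ∈ V, Ad d g X ∈ V) : V = ⊥ ∨ V = ⊤ := by
  have hcompl : IsCompl V ((frobeniusForm d).orthogonal V) := by
    rw [LinearMap.BilinForm.isCompl_orthogonal_iff_disjoint frobeniusForm_isSymm.isRefl,
      Submodule.disjoint_def]
    intro X hX hX'
    have h0 : frobeniusForm d X X = 0 := hX' X hX
    rw [frobeniusForm_apply, trace_conjTranspose_mul_self_re] at h0
    exact Subtype.ext (norm_eq_zero.1 (pow_eq_zero_iff two_ne_zero |>.1 h0))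
  have hW : ∀ g ∈ H, ∀ X ∈ (frobeniusForm d).orthogonal V,
      Ad d g X ∈ (frobeniusForm d).orthogonal V := by
    intro g hg X hX Y hY
    have : frobeniusForm d (Ad d g⁻¹ Y) X = 0 := hX _ (hV _ (H.inv_mem hg) Y hY)
    rw [← frobeniusForm_Ad] at this
    exact this
  set P : Module.End ℝ (su d) := V.projection _ hcompl with hP
  have hPV : ∀ X ∈ V, P X = X := fun X hX => Submodule.projection_apply_of_mem_left hcompl hX
  have hPW : ∀ X ∈ (frobeniusForm d).orthogonal V, P X = 0 := fun X hX =>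
    (Submodule.projection_apply_eq_zero_iff hcompl).2 hX
  have hPS : P ∈ commutantAd S := by
    intro g hg
    rw [Ring.lie_def, sub_eq_zero]
    ext1 X
    have hX : X ∈ V ⊔ (frobeniusForm d).orthogonal V := hcompl.sup_eq_top ▸ Submodule.mem_top
    obtain ⟨v, hv, w, hw, rfl⟩ := Submodule.mem_sup.1 hX
    rw [Module.End.mul_apply, Module.End.mul_apply, map_add, map_add, map_add, hPV v hv, hPW w hw,
      hPV _ (hV g (hSH hg) v hv), hPW _ (hW g (hSH hg) w hw), add_zero, add_zero]
  rw [hS] at hPS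
  obtain ⟨r, hr⟩ := hPS
  have hPr : ∀ X, P X = r • X := fun X => by rw [hr]; rfl
  rcases eq_or_ne r 0 with rfl | hr0
  · left
    rw [Submodule.eq_bot_iff]
    intro X hX
    rw [← hPV X hX, hPr, zero_smul]
  · right
    have hW0 : (frobeniusForm d).orthogonal V = ⊥ := by
      rw [Submodule.eq_bot_iff]
      intro X hX
      have h0 := hPW X hX
      rw [hPr] at h0
      exact (smul_eq_zero.1 h0).resolve_left hr0
    rw [hW0] at hcompl
    exact eq_top_of_isCompl_bot hcompl

/-! ### Words, the full adjoint representation, and elements near the center -/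

/-- In a compact group, the closure of the set of words is a subgroup. -/
theorem closure_words_eq {K : Type*} [Group K] [TopologicalSpace K] [IsTopologicalGroup K]
    [CompactSpace K] (S : Set K) :
    closure (words S) = ((Subgroup.closure S).topologicalClosure : Set K) := by
  have hw : words S = (Submonoid.closure S : Set K) := by
    apply Set.Subset.antisymm
    · refine Set.iUnion_subset fun n => ?_
      induction n with
      | zero => rw [pow_zero]; exact Set.one_subset.2 (Submonoid.one_mem _)
      | succ n ih =>
        rw [pow_succ]
        rintro _ ⟨x, hx, y, hy, rfl⟩
        exact Submonoid.mul_mem _ (ih hx) (Submonoid.subset_closure hy)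
    · intro x hx
      induction hx using Submonoid.closure_induction with
      | mem x hx => exact Set.mem_iUnion.2 ⟨1, by rwa [pow_one]⟩
      | one => exact Set.mem_iUnion.2 ⟨0, by rw [pow_zero]; exact Set.one_mem_one⟩
      | mul x y _ _ hx hy =>
        obtain ⟨m, hm⟩ := Set.mem_iUnion.1 hx
        obtain ⟨n, hn⟩ := Set.mem_iUnion.1 hy
        exact Set.mem_iUnion.2 ⟨m + n, by rw [pow_add]; exact Set.mul_mem_mul hm hn⟩
  rw [hw, closure_submonoidClosure_eq_closure_subgroupClosure, Subgroup.topologicalClosure_coe]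

/-- A linear map commuting with `Ad_g` for all `g ∈ S` does so for all `g` in the closed subgroup
generated by `S`. -/
theorem commute_Ad_of_mem_closure {S : Set (SU d)} {A : Module.End ℝ (su d)}
    (hA : A ∈ commutantAd S) {g : SU d} (hg : g ∈ closure (words S)) : Commute A (Ad d g) := by
  rw [closure_words_eq] at hg
  obtain ⟨A', hA'⟩ := LinearMap.exists_extend (p := (su d).toSubmodule)
    ((su d).toSubmodule.subtype ∘ₗ A)
  have hA'X : ∀ X : su d, A' (X : Matrix (Fin d) (Fin d) ℂ) = (A X : Matrix (Fin d) (Fin d) ℂ) :=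
    fun X => LinearMap.congr_fun hA' X
  have hcont : Continuous A' := LinearMap.continuous_of_finiteDimensional A'
  have hclosed : IsClosed {g : SU d | Commute A (Ad d g)} := by
    have e : {g : SU d | Commute A (Ad d g)} = ⋂ X : su d, {g : SU d |
        A' ((g : Matrix (Fin d) (Fin d) ℂ) * X * (g : Matrix (Fin d) (Fin d) ℂ)ᴴ) =
          (g : Matrix (Fin d) (Fin d) ℂ) * (A X : Matrix (Fin d) (Fin d) ℂ) *
            (g : Matrix (Fin d) (Fin d) ℂ)ᴴ} := by
      ext g
      simp only [Set.mem_ofPred_eq, Set.mem_iInter]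
      constructor
      · intro h X
        rw [← Ad_apply_coe, ← Ad_apply_coe, hA'X]
        exact congrArg Subtype.val (LinearMap.congr_fun h.eq X)
      · intro h
        refine LinearMap.ext fun X => Subtype.ext ?_
        have := h X
        rw [← Ad_apply_coe, ← Ad_apply_coe, hA'X] at this
        exact this
    rw [e]
    have hv : Continuous fun g : SU d => (g : Matrix (Fin d) (Fin d) ℂ) := continuous_subtype_val
    refine isClosed_iInter fun X => isClosed_eq (hcont.comp ?_) ?_
    · exact (hv.matrix_mul continuous_const).matrix_mul hv.matrix_conjTranspose
    · exact (hv.matrix_mul continuous_const).matrix_mul hv.matrix_conjTranspose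
  refine closure_minimal (s := (Subgroup.closure S : Set (SU d))) ?_ hclosed hg
  intro x hx
  induction hx using Subgroup.closure_induction with
  | mem x hx =>
    have := hA x hx
    rwa [Ring.lie_def, sub_eq_zero] at this
  | one => rw [Set.mem_ofPred_eq, map_one]; exact Commute.one_right A
  | mul x y _ _ hx hy => rw [Set.mem_ofPred_eq, map_mul]; exact hx.mul_right hy
  | inv x _ hx =>
    have h1 : Ad d x * Ad d x⁻¹ = 1 := by rw [← map_mul, mul_inv_cancel, map_one]
    have h2 : Ad d x⁻¹ * Ad d x = 1 := by rw [← map_mul, inv_mul_cancel, map_one]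
    exact Commute.units_inv_right (u := ⟨Ad d x, Ad d x⁻¹, h1, h2⟩) hx

/-- Conjugation by a unitary matrix equals conjugation by a special unitary one. -/
theorem exists_SU_conj_eq (hd : 0 < d) {U : Matrix (Fin d) (Fin d) ℂ}
    (hU : U ∈ Matrix.unitaryGroup (Fin d) ℂ) :
    ∃ g : SU d, ∀ X : Matrix (Fin d) (Fin d) ℂ,
      (g : Matrix (Fin d) (Fin d) ℂ) * X * (g : Matrix (Fin d) (Fin d) ℂ)ᴴ = U * X * Uᴴ := by
  have hdet : ‖U.det‖ = 1 := CStarRing.norm_of_mem_unitary (Matrix.det_of_mem_unitary hU)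
  obtain ⟨c, hc⟩ := IsAlgClosed.exists_pow_nat_eq (U.det)⁻¹ hd
  have hc1 : ‖c‖ = 1 := by
    rw [← pow_eq_one_iff_of_nonneg (norm_nonneg c) hd.ne', ← norm_pow, hc, norm_inv, hdet, inv_one]
  have hU0 : U.det ≠ 0 := fun h => by simp [h] at hdet
  refine ⟨⟨c • U, smul_mem_unitaryGroup hc1 hU, ?_⟩, fun X => ?_⟩
  · change (c • U).det = 1
    rw [Matrix.det_smul, Fintype.card_fin, hc, inv_mul_cancel₀ hU0]
  · change (c • U) * X * (c • U)ᴴ = _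
    have hcc : c * star c = 1 := by
      rw [Complex.star_def, Complex.mul_conj, Complex.normSq_eq_norm_sq, hc1]; simp
    rw [Matrix.conjTranspose_smul, smul_mul_assoc, smul_mul_smul_comm, hcc, one_smul]

/-- `i (E_jj - E_kk)`, a root generator of the diagonal subalgebra of `𝔰𝔲(d)`. -/
def diagRoot (j k : Fin d) : su d :=
  ⟨Matrix.diagonal fun l => Complex.I * ((Pi.single j 1 - Pi.single k 1 : Fin d → ℝ) l : ℂ),
    diagonal_mem_su (by simp [Finset.sum_sub_distrib])⟩

theorem diagRoot_coe (j k : Fin d) : (diagRoot j k : Matrix (Fin d) (Fin d) ℂ) =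
    Matrix.diagonal fun l => Complex.I * ((Pi.single j 1 - Pi.single k 1 : Fin d → ℝ) l : ℂ) := rfl

theorem diagRoot_apply_self (j k l : Fin d) : (diagRoot j k : Matrix (Fin d) (Fin d) ℂ) l l =
    Complex.I * (((Pi.single j 1 - Pi.single k 1 : Fin d → ℝ) l : ℝ) : ℂ) :=
  Matrix.diagonal_apply_eq _ _

theorem diagRoot_sub (j k l : Fin d) : diagRoot j l - diagRoot k l = diagRoot j k := by
  refine Subtype.ext ?_
  change (diagRoot j l : Matrix (Fin d) (Fin d) ℂ) - (diagRoot k l : Matrix (Fin d) (Fin d) ℂ) = _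
  rw [diagRoot_coe, diagRoot_coe, diagRoot_coe, Matrix.diagonal_sub]
  congr 1
  funext i
  simp only [Pi.sub_apply]
  push_cast
  ring

theorem diagRoot_self (j : Fin d) : diagRoot j j = 0 :=
  Subtype.ext (by rw [diagRoot_coe, sub_self]; simp)

theorem permMatrix_conj (σ : Equiv.Perm (Fin d)) (M : Matrix (Fin d) (Fin d) ℂ) :
    σ.permMatrix ℂ * M * (σ.permMatrix ℂ)ᴴ = M.submatrix σ σ := by
  rw [Matrix.conjTranspose_permMatrix, PEquiv.toMatrix_toPEquiv_mul, PEquiv.mul_toMatrix_toPEquiv]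
  rfl

theorem permMatrix_mem_unitaryGroup (σ : Equiv.Perm (Fin d)) :
    σ.permMatrix ℂ ∈ Matrix.unitaryGroup (Fin d) ℂ := by
  have h := permMatrix_conj σ 1
  rw [Matrix.mul_one, Matrix.submatrix_one_equiv] at h
  rwa [Matrix.mem_unitaryGroup_iff, Matrix.star_eq_conjTranspose]

section Schur

variable {A : Module.End ℝ (su d)}

theorem apply_unitary_conj (hd : 0 < d) (hA : ∀ g : SU d, Commute A (Ad d g))
    {U : Matrix (Fin d) (Fin d) ℂ} (hU : U ∈ Matrix.unitaryGroup (Fin d) ℂ) (X : su d) :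
    A ⟨U * (X : Matrix (Fin d) (Fin d) ℂ) * Uᴴ, unitary_conj_mem_su hU X.2⟩ =
      ⟨U * (A X : Matrix (Fin d) (Fin d) ℂ) * Uᴴ, unitary_conj_mem_su hU (A X).2⟩ := by
  obtain ⟨g, hg⟩ := exists_SU_conj_eq hd hU
  have h1 : ∀ Y : su d, (⟨U * (Y : Matrix (Fin d) (Fin d) ℂ) * Uᴴ, unitary_conj_mem_su hU Y.2⟩ : su d)
      = Ad d g Y := fun Y => Subtype.ext (by rw [Ad_apply_coe, hg])
  rw [h1, h1]
  exact LinearMap.congr_fun (hA g).eq X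

/-- If conjugation by `U` multiplies `X` by a real scalar, it multiplies `A X` by the same one. -/
theorem unitary_conj_apply_eq_smul (hd : 0 < d) (hA : ∀ g : SU d, Commute A (Ad d g))
    {U : Matrix (Fin d) (Fin d) ℂ} (hU : U ∈ Matrix.unitaryGroup (Fin d) ℂ) {X : su d} {ε : ℝ}
    (hX : U * (X : Matrix (Fin d) (Fin d) ℂ) * Uᴴ = ε • (X : Matrix (Fin d) (Fin d) ℂ)) :
    U * (A X : Matrix (Fin d) (Fin d) ℂ) * Uᴴ = ε • (A X : Matrix (Fin d) (Fin d) ℂ) := by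
  have h1 := apply_unitary_conj hd hA hU X
  have h2 : (⟨U * (X : Matrix (Fin d) (Fin d) ℂ) * Uᴴ, unitary_conj_mem_su hU X.2⟩ : su d) = ε • X :=
    Subtype.ext hX
  rw [h2, map_smul] at h1
  exact (congrArg Subtype.val h1).symm

/-- `A` preserves the diagonal subalgebra, the centralizer of the diagonal unitaries. -/
theorem apply_diagonal_offDiag (hd : 0 < d) (hA : ∀ g : SU d, Commute A (Ad d g)) {X : su d}
    {μ : Fin d → ℂ} (hX : (X : Matrix (Fin d) (Fin d) ℂ) = Matrix.diagonal μ) {j l : Fin d}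
    (hjl : j ≠ l) : (A X : Matrix (Fin d) (Fin d) ℂ) j l = 0 := by
  -- conjugation by the reflection `1 - 2 E_jj` changes the sign of the `(j, l)` entry
  set ν : Fin d → ℂ := fun i => if i = j then -1 else 1 with hν
  have hU : Matrix.diagonal ν ∈ Matrix.unitaryGroup (Fin d) ℂ :=
    diagonal_mem_unitaryGroup fun i => by simp only [hν]; split_ifs <;> simp
  have hstar : star ν = ν := by
    funext i
    simp only [hν, Pi.star_apply]; split_ifs <;> simp
  have hνν : ∀ i, ν i * ν i = 1 := fun i => by simp only [hν]; split_ifs <;> simp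
  have hfix : Matrix.diagonal ν * (X : Matrix (Fin d) (Fin d) ℂ) * (Matrix.diagonal ν)ᴴ =
      (1 : ℝ) • (X : Matrix (Fin d) (Fin d) ℂ) := by
    rw [hX, Matrix.diagonal_conjTranspose, hstar, Matrix.diagonal_mul_diagonal,
      Matrix.diagonal_mul_diagonal, one_smul]
    congr 1
    funext i
    rw [mul_right_comm, hνν, one_mul]
  have h := unitary_conj_apply_eq_smul hd hA hU hfix
  rw [Matrix.diagonal_conjTranspose, hstar, one_smul] at h
  have h2 := congrFun (congrFun h j) l
  rw [Matrix.mul_diagonal, Matrix.diagonal_mul] at h2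
  simp only [hν, if_true, if_neg hjl.symm, mul_one, neg_one_mul] at h2
  exact self_eq_neg.1 h2.symm

/-- `A (i (E_jj - E_kk))` is diagonal and changes sign under the transposition of `j` and `k`, so only
its entries at `j` and `k` survive, and they are opposite. -/
theorem exists_apply_diagRoot (hd : 0 < d) (hA : ∀ g : SU d, Commute A (Ad d g)) (j k : Fin d) :
    ∃ r : ℝ, A (diagRoot j k) = r • diagRoot j k := by
  rcases eq_or_ne j k with rfl | hjk
  · refine ⟨0, ?_⟩
    rw [diagRoot_self, map_zero, smul_zero]
  set D : Matrix (Fin d) (Fin d) ℂ := (A (diagRoot j k) : Matrix (Fin d) (Fin d) ℂ) with hD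
  -- the transposition of `j` and `k` changes the sign of `diagRoot j k`
  set σ : Equiv.Perm (Fin d) := Equiv.swap j k with hσ
  have hWU := permMatrix_mem_unitaryGroup σ
  have hsign : σ.permMatrix ℂ * (diagRoot j k : Matrix (Fin d) (Fin d) ℂ) * (σ.permMatrix ℂ)ᴴ =
      (-1 : ℝ) • (diagRoot j k : Matrix (Fin d) (Fin d) ℂ) := by
    rw [permMatrix_conj, diagRoot_coe, Matrix.submatrix_diagonal_equiv, ← Matrix.diagonal_smul]
    congr 1
    funext l
    have h1 : (Pi.single j 1 : Fin d → ℝ) (σ l) = (Pi.single k 1 : Fin d → ℝ) l := by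
      simp only [Pi.single_apply, hσ, Equiv.swap_apply_eq_iff, Equiv.swap_apply_left]
    have h2 : (Pi.single k 1 : Fin d → ℝ) (σ l) = (Pi.single j 1 : Fin d → ℝ) l := by
      simp only [Pi.single_apply, hσ, Equiv.swap_apply_eq_iff, Equiv.swap_apply_right]
    simp only [Function.comp_apply, Pi.smul_apply, Pi.sub_apply, h1, h2]
    rw [neg_one_smul, ← mul_neg, ← Complex.ofReal_neg, neg_sub]
  have h := unitary_conj_apply_eq_smul hd hA hWU hsign
  rw [permMatrix_conj, ← hD] at h
  have hdiag : ∀ l, D (σ l) (σ l) = -D l l := fun l => by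
    have := congrFun (congrFun h l) l
    simpa using this
  have hskew : ∀ l, (D l l).re = 0 := fun l => by
    have h1 : Dᴴ = -D := (A (diagRoot j k)).2.1
    have h2 := congrArg Complex.re (congrFun (congrFun h1 l) l)
    simp at h2
    linarith
  refine ⟨(D j j).im, Subtype.ext ?_⟩
  change D = (D j j).im • (diagRoot j k : Matrix (Fin d) (Fin d) ℂ)
  have hjj : D j j = Complex.I * ((D j j).im : ℂ) := by
    apply Complex.ext <;> simp [hskew]
  have hkk : D k k = -D j j := by
    have := hdiag j
    rwa [hσ, Equiv.swap_apply_left] at this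
  ext a b
  rw [Matrix.smul_apply, diagRoot_coe]
  rcases eq_or_ne a b with rfl | hab
  · rw [Matrix.diagonal_apply_eq, Pi.sub_apply, Complex.real_smul]
    rcases eq_or_ne a j with rfl | haj
    · rw [Pi.single_eq_same, Pi.single_eq_of_ne hjk]
      nth_rewrite 1 [hjj]
      push_cast
      ring
    rcases eq_or_ne a k with rfl | hak
    · rw [Pi.single_eq_same, Pi.single_eq_of_ne haj, hkk]
      nth_rewrite 1 [hjj]
      push_cast
      ring
    · rw [Pi.single_eq_of_ne haj, Pi.single_eq_of_ne hak]
      have := hdiag a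
      rw [hσ, Equiv.swap_apply_of_ne_of_ne haj hak] at this
      rw [self_eq_neg.1 this]
      simp
  · rw [Matrix.diagonal_apply_ne _ hab, smul_zero]
    exact apply_diagonal_offDiag hd hA (diagRoot_coe j k) hab

/-- `A` acts by one scalar on all root generators. -/
theorem exists_apply_diagRoot_eq (hA : ∀ g : SU d, Commute A (Ad d g)) {j₀ j₁ : Fin d}
    (h01 : j₁ ≠ j₀) : ∃ r : ℝ, ∀ j, A (diagRoot j j₀) = r • diagRoot j j₀ := by
  have hd : 0 < d := j₀.pos
  obtain ⟨r, hr⟩ := exists_apply_diagRoot hd hA j₁ j₀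
  refine ⟨r, fun j => ?_⟩
  rcases eq_or_ne j j₀ with rfl | hj0
  · rw [diagRoot_self, map_zero, smul_zero]
  rcases eq_or_ne j j₁ with rfl | hj1
  · exact hr
  obtain ⟨r', hr'⟩ := exists_apply_diagRoot hd hA j j₀
  obtain ⟨s, hs⟩ := exists_apply_diagRoot hd hA j j₁
  rw [← diagRoot_sub j j₁ j₀, map_sub, hr, hr'] at hs
  have hs' : ∀ l, (r' : ℂ) * (diagRoot j j₀ : Matrix (Fin d) (Fin d) ℂ) l l -
      (r : ℂ) * (diagRoot j₁ j₀ : Matrix (Fin d) (Fin d) ℂ) l l =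
      (s : ℂ) * ((diagRoot j j₀ : Matrix (Fin d) (Fin d) ℂ) l l -
        (diagRoot j₁ j₀ : Matrix (Fin d) (Fin d) ℂ) l l) := fun l =>
    congrFun (congrFun (congrArg Subtype.val hs) l) l
  have e1 := hs' j
  have e2 := hs' j₁
  simp only [diagRoot_apply_self, Pi.sub_apply, Pi.single_apply, if_neg hj0, if_neg hj1,
    if_neg h01, if_neg hj1.symm, if_true] at e1 e2
  have e1' : r' = s := by
    have := congrArg Complex.im e1
    simpa using this
  have e2' : r = s := by
    have := congrArg Complex.im e2
    simpa using this
  rw [hr', e1', e2']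

/-- Schur's lemma for the adjoint representation: every real-linear endomorphism of `𝔰𝔲(d)` that
commutes with it is a real scalar. -/
theorem exists_eq_smul_one_of_commute_Ad (hd : 2 ≤ d) (hA : ∀ g : SU d, Commute A (Ad d g)) :
    ∃ r : ℝ, A = r • (1 : Module.End ℝ (su d)) := by
  have hd0 : 0 < d := by omega
  obtain ⟨r, hr⟩ := exists_apply_diagRoot_eq hA (j₀ := ⟨0, hd0⟩) (j₁ := ⟨1, hd⟩) (by simp)
  set j₀ : Fin d := ⟨0, hd0⟩ with hj₀
  refine ⟨r, LinearMap.ext fun X => ?_⟩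
  rw [LinearMap.smul_apply, Module.End.one_apply]
  obtain ⟨U, hU, a, hX⟩ := exists_unitary_diagonal_of_skew X.2.1
  have ha : ∑ j, a j = 0 := by
    have h1 : (X : Matrix (Fin d) (Fin d) ℂ).trace = 0 := X.2.2
    rw [hX, trace_unitary_conj hU, Matrix.trace_diagonal, ← Finset.mul_sum] at h1
    have h2 := (mul_eq_zero.1 h1).resolve_left Complex.I_ne_zero
    exact_mod_cast h2
  have hsum : (⟨_, diagonal_mem_su ha⟩ : su d) = ∑ j, a j • diagRoot j j₀ := by
    refine Subtype.ext ?_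
    have hc : ((∑ j, a j • diagRoot j j₀ : su d) : Matrix (Fin d) (Fin d) ℂ) =
        ∑ j, a j • (diagRoot j j₀ : Matrix (Fin d) (Fin d) ℂ) :=
      map_sum (su d).toSubmodule.subtype _ _
    rw [hc]
    simp only [diagRoot_coe, ← Matrix.diagonal_smul]
    refine Eq.trans ?_ (map_sum (Matrix.diagonalAddMonoidHom (Fin d) ℂ) (fun j => a j • fun l =>
      Complex.I * ((Pi.single j 1 - Pi.single j₀ 1 : Fin d → ℝ) l : ℂ)) Finset.univ)
    change _ = Matrix.diagonal _
    congr 1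
    funext l
    rw [Finset.sum_apply]
    simp only [Pi.smul_apply, Pi.sub_apply, Complex.real_smul]
    have e : a l = ∑ j, a j * ((Pi.single j 1 : Fin d → ℝ) l - (Pi.single j₀ 1 : Fin d → ℝ) l) := by
      simp only [mul_sub, Finset.sum_sub_distrib, ← Finset.sum_mul, ha, zero_mul, sub_zero,
        Pi.single_apply]
      simp
    rw [e]
    push_cast
    rw [Finset.mul_sum]
    exact Finset.sum_congr rfl fun j _ => by ring
  have hdiag : A ⟨_, diagonal_mem_su ha⟩ = r • (⟨_, diagonal_mem_su ha⟩ : su d) := by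
    rw [hsum, map_sum, Finset.smul_sum]
    refine Finset.sum_congr rfl fun j _ => ?_
    rw [map_smul, hr, smul_comm]
  have hXe : X = ⟨_, unitary_conj_mem_su hU (diagonal_mem_su ha)⟩ := Subtype.ext hX
  have h3 := apply_unitary_conj hd0 hA hU ⟨_, diagonal_mem_su ha⟩
  rw [hdiag] at h3
  rw [hXe, h3]
  refine Subtype.ext ?_
  change U * (r • _) * Uᴴ = r • (U * _ * Uᴴ)
  rw [mul_smul_comm, smul_mul_assoc]

end Schur

/-- There are noncentral elements near the center: `diag(z, z̄, 1, …, 1)` with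
`z = (12 + 5i) / 13`, at squared distance `4 / 13` from the identity. -/
theorem exists_mem_nearCenter_notMem_center (hd : 2 ≤ d) :
    ∃ g ∈ nearCenter d, g ∉ Subgroup.center (SU d) := by
  set j : Fin d := ⟨0, by omega⟩
  set k : Fin d := ⟨1, hd⟩
  have hjk : j ≠ k := by simp [j, k]
  set z : ℂ := ⟨12 / 13, 5 / 13⟩ with hz
  set ν : Fin d → ℂ := fun i => if i = j then z else if i = k then star z else 1 with hν
  have hνj : ν j = z := if_pos rfl
  have hνk : ν k = star z := by simp only [hν, if_neg hjk.symm, if_true]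
  have hν1 : ∀ i, i ≠ j ∧ i ≠ k → ν i = 1 := fun i hi => by simp only [hν, if_neg hi.1, if_neg hi.2]
  have hz1 : ‖z‖ = 1 := by
    rw [← pow_eq_one_iff_of_nonneg (norm_nonneg _) two_ne_zero, ← Complex.normSq_eq_norm_sq,
      Complex.normSq_apply]
    norm_num [hz]
  have hzz : ‖z - 1‖ ^ 2 = 2 / 13 := by
    rw [← Complex.normSq_eq_norm_sq, Complex.normSq_apply]
    norm_num [hz]
  have hU : Matrix.diagonal ν ∈ Matrix.unitaryGroup (Fin d) ℂ :=
    diagonal_mem_unitaryGroup fun i => by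
      simp only [hν]
      split_ifs <;> simp [hz1]
  have hdet : (Matrix.diagonal ν).det = 1 := by
    rw [Matrix.det_diagonal, Fintype.prod_eq_mul j k hjk hν1, hνj, hνk, Complex.star_def,
      Complex.mul_conj, Complex.normSq_eq_norm_sq, hz1]
    simp
  set g : SU d := ⟨Matrix.diagonal ν, hU, hdet⟩ with hg
  refine ⟨g, ⟨1, Subgroup.one_mem _, ?_⟩, fun hcen => ?_⟩
  · rw [frobeniusNorm_eq_norm]
    change ‖Matrix.diagonal ν - 1‖ < _
    have hstar : ‖star z - 1‖ = ‖z - 1‖ := by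
      rw [← norm_star (z - 1), star_sub, star_one]
    have hsq : ‖Matrix.diagonal ν - 1‖ ^ 2 = 4 / 13 := by
      rw [← Matrix.diagonal_one, Matrix.diagonal_sub, Matrix.frobenius_norm_diagonal,
        EuclideanSpace.norm_sq_eq]
      change ∑ i, ‖ν i - 1‖ ^ 2 = _
      rw [Fintype.sum_eq_add j k hjk fun i hi => by rw [hν1 i hi]; simp, hνj, hνk, hstar, hzz]
      norm_num
    refine lt_of_pow_lt_pow_left₀ 2 (by positivity) ?_
    rw [hsq, div_pow, Real.sq_sqrt zero_le_two]
    norm_num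
  · obtain ⟨w, hw⟩ := exists_SU_conj_eq (by omega : 0 < d)
      (permMatrix_mem_unitaryGroup (Equiv.swap j k))
    have h1 := hw (g : Matrix (Fin d) (Fin d) ℂ)
    rw [center_coe_comm hcen, mul_assoc, ← coe_inv_SU, coe_mul_coe_inv, mul_one,
      permMatrix_conj] at h1
    have h2 := congrFun (congrFun h1 j) j
    rw [Matrix.submatrix_apply, Equiv.swap_apply_left] at h2
    change Matrix.diagonal ν j j = Matrix.diagonal ν k k at h2
    rw [Matrix.diagonal_apply_eq, Matrix.diagonal_apply_eq, hνj, hνk] at h2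
    have h3 := congrArg Complex.im h2
    norm_num [hz] at h3

/-- A closed subgroup on which `Ad` is irreducible and which has noncentral elements near the center
is all of `SU(d)`. -/
theorem eq_top_of_irreducible (hd : 0 < d) {H : Subgroup (SU d)} (hH : IsClosed (H : Set (SU d)))
    (hirr : ∀ V : Submodule ℝ (su d), (∀ g ∈ H, ∀ X ∈ V, Ad d g X ∈ V) → V = ⊥ ∨ V = ⊤)
    (hnc : ¬ ((H : Set (SU d)) ∩ nearCenter d ⊆ (Subgroup.center (SU d) : Set (SU d)))) :
    H = ⊤ := by
  rcases finite_or_infinite H with hfin | hinf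
  · exact absurd (subset_center_of_fixedNearCenter hd
      (fun g hg h hh hgB hhB => mul_comm_of_mem_nearCenter hg hh hgB hhB)
      (hirr _ fun g hg X hX => Ad_mem_fixedNearCenter hg hX)) hnc
  · exact eq_top_of_tangentSpace_eq_top hd hH
      ((hirr _ fun g hg X hX => Ad_mem_tangentSpace hH hg hX).resolve_left
        (tangentSpace_ne_bot hH hinf))

end GateUniversality

open GateUniversality in
theorem mainTheorem1 (d : ℕ) (hd : 2 ≤ d) (S : Set (GateUniversality.SU d))
    (H : Set (GateUniversality.SU d)) (hH : H = closure (GateUniversality.words S)) :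
    H = Set.univ ↔
      (GateUniversality.commutantAd S =
          {A | ∃ r : ℝ, A = r • (1 : Module.End ℝ (GateUniversality.su d))} ∧
        ¬ (H ∩ GateUniversality.nearCenter d ⊆
            (Subgroup.center (GateUniversality.SU d) : Set (GateUniversality.SU d)))) := by
  subst hH
  constructor
  · intro hHu
    refine ⟨Set.Subset.antisymm (fun A hA => ?_) ?_, fun hsub => ?_⟩
    · refine exists_eq_smul_one_of_commute_Ad hd fun g => commute_Ad_of_mem_closure hA ?_
      rw [hHu]
      trivial
    · rintro _ ⟨r, rfl⟩ g -
      exact (Commute.smul_left (Commute.one_left _) r).lie_eq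
    · obtain ⟨g, hgB, hgc⟩ := exists_mem_nearCenter_notMem_center hd
      exact hgc (hsub ⟨hHu ▸ Set.mem_univ g, hgB⟩)
  · rintro ⟨hcomm, hnc⟩
    rw [closure_words_eq] at hnc ⊢
    have hSH : S ⊆ ((Subgroup.closure S).topologicalClosure : Set (SU d)) :=
      Subgroup.subset_closure.trans (Subgroup.le_topologicalClosure _)
    rw [eq_top_of_irreducible (by omega) (Subgroup.isClosed_topologicalClosure _)
      (fun V hV => eq_bot_or_eq_top_of_commutantAd hcomm hSH V hV) hnc, Subgroup.coe_top]
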